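/- Let $n\ge 2$ be even. An $n$-dimensional pseudomanifold is a finite simplicial complex that is the union of its $n$-simplices, in which every $(n-1)$-face lies in exactly two $n$-simplices, and for which the graph whose vertices are the $n$-simplices, with two of them adjacent when they share an $(n-1)$-face, is connected. Give every $(n-1)$-face weight $1$. If $M$ is an $n$-dimensional pseudomanifold with $N$ top-dimensional simplices, then for an ordering $\mathcal O\colon T_1,\dots,T_N$ of them and $0\le j\le N$ let $\Lambda(j)$ be the total weight (here, the number) of the $(n-1)$-faces of $M$ that lie both in some $T_i$ with $i\le j$ and in some $T_i$ with $i>j$. An index $t\in\{1,\dots,N-1\}$ is a maximum of $\mathcal O$ if there are $0\le t_-<t<t_+\le N$ with $\Lambda(t_-)<\Lambda(t_-+1)$, $\Lambda(t_+)<\Lambda(t_+-1)$ and $\Lambda(t)=\Lambda(k)$ for all $t_-+1\le k\le t_+-1$. The width of $\mathcal O$ is the sequence of the values of $\Lambda$ at the maxima of $\mathcal O$, with repetitions, in non-increasing order; widths are compared lexicographically (a proper initial segment being smaller). Let $\Omega(M)$ be the least width of an ordering of the top-dimensional simplices of $M$. Let $M_1$ and $M_2$ be $n$-dimensional pseudomanifolds,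 and let $M=M_1\# M_2$ be any connected sum of them: choose an $n$-simplex $C_i$ of $M_i$ for $i=1,2$, remove $C_i$ (but not its proper faces) from $M_i$, and glue the two resulting complexes along an arbitrary simplicial homeomorphism $\partial C_1\to\partial C_2$. Then \[ \max\bigl(\Omega(M_1),\Omega(M_2)\bigr)\le \Omega(M). \] -/

import Mathlib

open scoped NNReal

/-- A finite (abstract) simplicial complex with vertices in `V`: a finite collection of nonempty
finite sets (the faces) closed under passing to nonempty subsets. A `d`-dimensional face is a face
with `d + 1` elements. -/
structure FiniteComplex (V : Type*) extends PreAbstractSimplicialComplex V where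
  finite_faces : faces.Finite

namespace FiniteComplex

/-- The `n`-dimensional faces, called bricks. -/
noncomputable def bricks {V : Type*} (K : FiniteComplex V) (n : ℕ) : Finset (Finset V) :=
  K.finite_faces.toFinset.filter (fun T => T.card = n + 1)

/-- The `(n - 1)`-dimensional faces, called facets. -/
noncomputable def facets {V : Type*} (K : FiniteComplex V) (n : ℕ) : Finset (Finset V) :=
  K.finite_faces.toFinset.filter (fun F => F.card = n)

/-- The graph whose vertices are the bricks, two distinct bricks being adjacent if and only if they
share a facet. -/
def dualGraph {V : Type*} (K : FiniteComplex V) (n : ℕ) : SimpleGraph {T // T ∈ K.bricks n} where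
  Adj S T := S ≠ T ∧ ∃ F ∈ K.facets n, F ⊆ S.1 ∧ F ⊆ T.1
  symm := ⟨fun _ _ h => ⟨h.1.symm, h.2.imp fun _ hF => ⟨hF.1, hF.2.2, hF.2.1⟩⟩⟩
  loopless := ⟨fun _ h => h.1 rfl⟩

/-- An `n`-dimensional pseudomanifold. -/
structure IsPseudomanifold {V : Type*} [DecidableEq V] (K : FiniteComplex V) (n : ℕ) : Prop where
  /-- The complex is the union of its `n`-simplices. -/
  union_bricks : ∀ s ∈ K.faces, ∃ T ∈ K.bricks n, s ⊆ T
  /-- Every `(n - 1)`-face lies in exactly two `n`-faces. -/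
  two_bricks : ∀ F ∈ K.facets n, ((K.bricks n).filter (fun T => F ⊆ T)).card = 2
  /-- The complex is strongly connected. -/
  connected : (K.dualGraph n).Connected

/-- An ordering of the `N` bricks. The brick which is `i`-th in the order, for `1 ≤ i ≤ N`, is the
one with value `i - 1` in `Fin N`. -/
abbrev Ordering {V : Type*} (K : FiniteComplex V) (n : ℕ) : Type _ :=
  {T // T ∈ K.bricks n} ≃ Fin (K.bricks n).card

/-- The level set at height `j`: the facets contained both in one of the first `j` bricks and in
one of the remaining bricks. -/
noncomputable def levelSet {V : Type*} (K : FiniteComplex V) (n : ℕ) (O : K.Ordering n) (j : ℕ) :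
    Finset (Finset V) :=
  open Classical in
  (K.facets n).filter (fun F =>
    (∃ T : {T // T ∈ K.bricks n}, (O T : ℕ) < j ∧ F ⊆ T.1) ∧
    (∃ T : {T // T ∈ K.bricks n}, j ≤ (O T : ℕ) ∧ F ⊆ T.1))

/-- The total weight `Λ(j)` of the level set at height `j`, for a weight system `ω` (of which only
the values at facets matter). -/
noncomputable def levelWeight {V : Type*} (K : FiniteComplex V) (n : ℕ) (ω : Finset V → ℝ≥0)
    (O : K.Ordering n) (j : ℕ) : ℝ≥0 :=
  ∑ F ∈ K.levelSet n O j, ω F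

/-- The index `t` is a local maximum of `Λ(0), …, Λ(N)`. -/
def IsMaximum (Λ : ℕ → ℝ≥0) (N t : ℕ) : Prop :=
  ∃ a b : ℕ, a < t ∧ t < b ∧ b ≤ N ∧
    Λ a < Λ (a + 1) ∧ Λ b < Λ (b - 1) ∧ ∀ k, a + 1 ≤ k → k ≤ b - 1 → Λ t = Λ k

/-- The width of an ordering: the sequence of the values of `Λ` at its maxima, with repetitions,
in non-increasing order. -/
noncomputable def orderingWidth {V : Type*} (K : FiniteComplex V) (n : ℕ) (ω : Finset V → ℝ≥0)
    (O : K.Ordering n) : List ℝ≥0 :=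
  open Classical in
  (((Finset.Ioo 0 (K.bricks n).card).filter
    (IsMaximum (K.levelWeight n ω O) (K.bricks n).card)).val.map
      (K.levelWeight n ω O)).sort (· ≥ ·)

/-- The width `Ω`: the least width of an ordering of the bricks, where the order on lists is the
lexicographic one (a proper initial segment of a list is smaller than the list). -/
noncomputable def width {V : Type*} (K : FiniteComplex V) (n : ℕ) (ω : Finset V → ℝ≥0) :
    List ℝ≥0 :=
  open Classical in
  (Finset.univ : Finset (K.Ordering n)).inf' ⟨(K.bricks n).equivFin, Finset.mem_univ _⟩
    (K.orderingWidth n ω)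

/-- The subcomplex obtained by removing the open star of `C`, that is, all faces containing `C`. If
`C` is a top-dimensional face, then `C` is the only face which is removed. -/
def remove {V : Type*} (K : FiniteComplex V) (C : Finset V) : FiniteComplex V where
  faces := {s ∈ K.faces | ¬ C ⊆ s}
  isRelLowerSet_faces := fun _ hs =>
    ⟨(K.isRelLowerSet_faces hs.1).1, fun _ hts ht =>
      ⟨(K.isRelLowerSet_faces hs.1).2 hts ht, fun h => hs.2 (h.trans hts)⟩⟩
  finite_faces := K.finite_faces.subset (fun _ h => h.1)

/-- The image of the second vertex set in the vertex set of the connected sum: the vertices of `C₂`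
are identified with those of `C₁` through `e`. -/
def glueVertex {V₁ V₂ : Type*} [DecidableEq V₂] {C₁ : Finset V₁} {C₂ : Finset V₂}
    (e : {v // v ∈ C₁} ≃ {v // v ∈ C₂}) (v : V₂) : V₁ ⊕ {v : V₂ // v ∉ C₂} :=
  if h : v ∈ C₂ then Sum.inl (e.symm ⟨v, h⟩).1 else Sum.inr ⟨v, h⟩

/-- The connected sum of `K₁` and `K₂` along the bricks `C₁` and `C₂` and the simplicial
homeomorphism `∂C₁ → ∂C₂` given by the bijection `e` of their vertices: remove `C₁` from `K₁` and
`C₂` from `K₂`, and glue the resulting complexes along `e`. -/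
def connectedSum {V₁ V₂ : Type*} [DecidableEq V₁] [DecidableEq V₂]
    (K₁ : FiniteComplex V₁) (K₂ : FiniteComplex V₂) (C₁ : Finset V₁) (C₂ : Finset V₂)
    (e : {v // v ∈ C₁} ≃ {v // v ∈ C₂}) : FiniteComplex (V₁ ⊕ {v : V₂ // v ∉ C₂}) where
  toPreAbstractSimplicialComplex :=
    (K₁.remove C₁).toPreAbstractSimplicialComplex.map Sum.inl ⊔
      (K₂.remove C₂).toPreAbstractSimplicialComplex.map (glueVertex e)
  finite_faces :=
    ((K₁.remove C₁).finite_faces.image _).union ((K₂.remove C₂).finite_faces.image _)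

end FiniteComplex

/-!
Counting facets, the number `Λ(j)` is the size of an edge cut in the dual graph of `M`, whose
vertices are the bricks and whose edges are the facets. The bricks of `M` are those of `M₁` other
than `C₁`, forming a set `A`, and those of `M₂` other than `C₂`, forming a set `B`. The dual graph
of `M₁` is obtained from that of `M` by contracting `B` to the vertex `C₁`, so the cuts of `M₁` are
the cuts of `M` which do not separate `B` (`IsGluing.card_facetCut_preimage`).

Let `κ(S)` be the size of the cut given by a set `S` of bricks of `M`. Three properties of `κ` carry
the argument (`IsOddMinCut`, proved for connected sums in `IsGluing.isOddMinCut`).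
* `κ` is symmetric and submodular.
* `κ(S)` has the parity of the number of elements of `S`: each brick has `n + 1` facets, which is an
  odd number. In particular `Λ` has no plateaus.
* `κ(S) ≥ n + 1 = κ(B)` unless `S` is empty or contains all bricks. In a pseudomanifold the facets
  of a cut form a nonzero cycle modulo `2`, which has at least `n + 1` facets
  (`IsPseudomanifold.le_card_facetCut`). This applies to `M₁` and `M₂`, and passes to `M` by
  uncrossing a cut with `A` (`IsGluing.le_card_facetCut`).

Now take an ordering of the bricks of `M` and let `S j` consist of its first `j` bricks. Let `p` be
the height just before the first brick of `B`, and `q` the height just after the last one. For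
`p < j < q` uncrossing with `B` shows that `κ(S j \ B)` and `κ(S j ∪ B)` are at most `Λ(j)`; moreover,
they differ by parity, and once the second one is smaller than the first one it remains so. Order
the bricks of `M₁` by keeping the order on `A` and by inserting `C₁` at a height `j₀` between `p`
and `q`: the values of `Λ` for this ordering are the `κ(S j \ B)` for `j ≤ j₀`, followed by the
`κ(S j ∪ B)` for `j ≥ j₀`. With `c` the largest value of `Λ` strictly between `p` and `q`, a suitable
`j₀` keeps all of them between `p` and `q` below `c` (`exists_switch`). As `Λ` takes values below
`c` at `p` and `q` (`IsOddMinCut.lt_insert`, `IsOddMinCut.lt_erase`), `c` is the height of a maximum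
of `Λ` which gets lost. All maxima of height at least `c` of the new ordering come from heights
below `p` or above `q`, where both orderings have the same values, so that they are also maxima of
`Λ`. Hence the width becomes smaller (`sequenceWidth_lt`, `IsOddMinCut.exists_sequenceWidth_lt`). By
the symmetry of `IsGluing` the same holds for `M₂`.
-/

/-! ### Comparing the widths of two sequences -/

/-- If the entries `≥ c` of a non-increasing list all occur at least as often in another one, and
`c` itself occurs more often there, then the first list is lexicographically smaller. -/
theorem List.lt_of_count_le_count {α : Type*} [LinearOrder α] (c : α) {l₁ l₂ : List α}
    (h₁ : l₁.Pairwise (· ≥ ·)) (h₂ : l₂.Pairwise (· ≥ ·))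
    (hle : ∀ x, c ≤ x → l₁.count x ≤ l₂.count x) (hlt : l₁.count c < l₂.count c) : l₁ < l₂ := by
  induction l₁ generalizing l₂ with
  | nil =>
    cases l₂ with
    | nil => simp at hlt
    | cons b l₂ => exact List.nil_lt_cons b l₂
  | cons a l₁ ih =>
    cases l₂ with
    | nil => simp at hlt
    | cons b l₂ =>
      rw [List.pairwise_cons] at h₁ h₂
      have hcb : c ≤ b := by
        have : c ∈ b :: l₂ := List.count_pos_iff.1 (by omega)
        rcases List.mem_cons.1 this with h | h
        · exact h.le
        · exact h₂.1 c h
      rw [List.cons_lt_cons_iff]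
      rcases lt_trichotomy a b with hab | rfl | hab
      · exact Or.inl hab
      · refine Or.inr ⟨rfl, ih h₁.2 h₂.2 (fun x hx => ?_) ?_⟩
        · have := hle x hx
          simp only [List.count_cons] at this
          omega
        · simp only [List.count_cons] at hlt
          omega
      · exfalso
        have ha := hle a (hcb.trans hab.le)
        have : a ∈ b :: l₂ := List.count_pos_iff.1 (by rw [List.count_cons_self] at ha; omega)
        rcases List.mem_cons.1 this with h | h
        · exact hab.ne' h
        · exact absurd (h₂.1 a h) (not_le.2 hab)

namespace FiniteComplex

/-- The values of `Λ(0), …, Λ(N)` at its maxima, with repetitions, in non-increasing order. -/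
noncomputable def sequenceWidth (Λ : ℕ → ℝ≥0) (N : ℕ) : List ℝ≥0 :=
  open Classical in
  (((Finset.Ioo 0 N).filter (IsMaximum Λ N)).val.map Λ).sort (· ≥ ·)

theorem isMaximum_of_lt {Λ : ℕ → ℝ≥0} {N t : ℕ} (h0 : 0 < t) (hN : t < N)
    (hl : Λ (t - 1) < Λ t) (hr : Λ (t + 1) < Λ t) : IsMaximum Λ N t := by
  refine ⟨t - 1, t + 1, by omega, by omega, by omega, ?_, by simpa using hr, fun k hk hk' => ?_⟩
  · rwa [Nat.sub_add_cancel h0]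
  · rw [show k = t by omega]

/-- In a sequence without plateaus the maxima are the strict local maxima. -/
theorem IsMaximum.lt {Λ : ℕ → ℝ≥0} {N t : ℕ} (hΛ : ∀ j < N, Λ j ≠ Λ (j + 1))
    (h : IsMaximum Λ N t) : 0 < t ∧ t < N ∧ Λ (t - 1) < Λ t ∧ Λ (t + 1) < Λ t := by
  obtain ⟨a, b, hat, htb, hbN, ha, hb, hk⟩ := h
  have h1 : a + 1 = t := by
    by_contra hne
    exact hΛ (a + 1) (by omega)
      ((hk (a + 1) le_rfl (by omega)).symm.trans (hk (a + 1 + 1) (by omega) (by omega)))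
  have h2 : b = t + 1 := by
    by_contra hne
    exact hΛ t (by omega) (hk (t + 1) (by omega) (by omega))
  subst h1 h2
  exact ⟨by omega, by omega, by simpa using ha, by simpa using hb⟩

open Classical in
theorem count_sequenceWidth (Λ : ℕ → ℝ≥0) (N : ℕ) (x : ℝ≥0) :
    (sequenceWidth Λ N).count x =
      ((Finset.Ioo 0 N).filter (fun t => IsMaximum Λ N t ∧ Λ t = x)).card := by
  unfold sequenceWidth
  rw [← Multiset.coe_count, Multiset.sort_eq, Multiset.count_map, ← Finset.filter_val,
    Finset.filter_filter, Finset.card_val]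
  simp only [eq_comm]

/-- Let two sequences without plateaus agree up to the index `p` of the first one and, shifted by
`k`, from the index `q` on. If in between the first one attains a peak `c`, and the second
one stays below `c`, then the second one has the smaller width: its maxima of height `≥ c` are
maxima of the first one outside of the interval from `p` to `q`. -/
theorem sequenceWidth_lt {Λ Λ' : ℕ → ℝ≥0} {N' k p m q : ℕ} {c : ℝ≥0}
    (hpm : p < m) (hmq : m < q) (hq : q ≤ N' + k)
    (hΛ : ∀ j < N' + k, Λ j ≠ Λ (j + 1)) (hΛ' : ∀ j < N', Λ' j ≠ Λ' (j + 1))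
    (hleft : ∀ t ≤ p, Λ' t = Λ t) (hright : ∀ t ≤ N', q ≤ t + k → Λ' t = Λ (t + k))
    (hmid : ∀ t, p ≤ t → t + k ≤ q → Λ' t < c)
    (hm : Λ m = c) (hc : ∀ j, p ≤ j → j ≤ q → Λ j ≤ c) :
    sequenceWidth Λ' N' < sequenceWidth Λ (N' + k) := by
  classical
  have hmmax : IsMaximum Λ (N' + k) m := by
    refine isMaximum_of_lt (by omega) (by omega) (lt_of_le_of_ne ?_ ?_) (lt_of_le_of_ne ?_ ?_)
    · exact hm ▸ hc _ (by omega) (by omega)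
    · have := hΛ (m - 1) (by omega)
      rwa [Nat.sub_add_cancel (by omega)] at this
    · exact hm ▸ hc _ (by omega) (by omega)
    · exact (hΛ m (by omega)).symm
  -- the maxima of height at least `c` of the second sequence, seen in the first one
  let g : ℕ → ℕ := fun t => if t < p then t else t + k
  have key : ∀ t, IsMaximum Λ' N' t → c ≤ Λ' t →
      (t < p ∨ q < t + k) ∧ Λ (g t) = Λ' t ∧ IsMaximum Λ (N' + k) (g t) := by
    intro t ht hct
    obtain ⟨h0, hN, hl, hr⟩ := ht.lt hΛ'
    have hout : t < p ∨ q < t + k := by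
      by_contra! h
      exact absurd (hmid t h.1 h.2) (not_lt.2 hct)
    refine ⟨hout, ?_⟩
    by_cases htp : t < p
    · have hg : g t = t := if_pos htp
      rw [hg]
      refine ⟨(hleft t htp.le).symm, isMaximum_of_lt h0 (by omega) ?_ ?_⟩
      · rwa [← hleft _ (by omega : t - 1 ≤ p), ← hleft t htp.le]
      · rwa [← hleft _ (by omega : t + 1 ≤ p), ← hleft t htp.le]
    · have hg : g t = t + k := if_neg htp
      have hqt : q < t + k := hout.resolve_left htp
      rw [hg]
      refine ⟨(hright t hN.le hqt.le).symm, isMaximum_of_lt (by omega) (by omega) ?_ ?_⟩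
      · rw [show t + k - 1 = (t - 1) + k by omega, ← hright _ (by omega) (by omega),
          ← hright t hN.le hqt.le]
        exact hl
      · rw [show t + k + 1 = (t + 1) + k by omega, ← hright _ (by omega) (by omega),
          ← hright t hN.le hqt.le]
        exact hr
  have hinj : ∀ s t, IsMaximum Λ' N' s → c ≤ Λ' s → IsMaximum Λ' N' t → c ≤ Λ' t →
      g s = g t → s = t := by
    intro s t hs hcs ht hct hst
    have h1 := (key s hs hcs).1
    have h2 := (key t ht hct).1
    simp only [g] at hst
    split_ifs at hst <;> omega
  have hgm : ∀ t, IsMaximum Λ' N' t → c ≤ Λ' t → g t ≠ m := by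
    intro t ht hct h
    have h1 := (key t ht hct).1
    simp only [g] at h
    split_ifs at h <;> omega
  have hmem : ∀ x, c ≤ x → ∀ t ∈ (Finset.Ioo 0 N').filter (fun t => IsMaximum Λ' N' t ∧ Λ' t = x),
      g t ∈ (Finset.Ioo 0 (N' + k)).filter (fun t => IsMaximum Λ (N' + k) t ∧ Λ t = x) := by
    intro x hx t ht
    obtain ⟨-, ht1, rfl⟩ := Finset.mem_filter.1 ht
    obtain ⟨-, h2, h3⟩ := key t ht1 hx
    have h4 := h3.lt hΛ
    exact Finset.mem_filter.2 ⟨Finset.mem_Ioo.2 ⟨h4.1, h4.2.1⟩, h3, h2⟩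
  have hinjOn : ∀ x, c ≤ x → Set.InjOn g
      ((Finset.Ioo 0 N').filter (fun t => IsMaximum Λ' N' t ∧ Λ' t = x)) := by
    intro x hx s hs t ht hst
    obtain ⟨-, hs1, hs2⟩ := Finset.mem_filter.1 (Finset.mem_coe.1 hs)
    obtain ⟨-, ht1, ht2⟩ := Finset.mem_filter.1 (Finset.mem_coe.1 ht)
    exact hinj s t hs1 (hs2 ▸ hx) ht1 (ht2 ▸ hx) hst
  refine List.lt_of_count_le_count c (Multiset.pairwise_sort _ _) (Multiset.pairwise_sort _ _)
    (fun x hx => ?_) ?_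
  · rw [count_sequenceWidth, count_sequenceWidth]
    exact Finset.card_le_card_of_injOn g (hmem x hx) (hinjOn x hx)
  · rw [count_sequenceWidth, count_sequenceWidth, ← Finset.card_image_of_injOn (hinjOn c le_rfl)]
    refine Finset.card_lt_card (Finset.ssubset_iff_of_subset ?_ |>.2 ⟨m, ?_, ?_⟩)
    · exact Finset.image_subset_iff.2 (hmem c le_rfl)
    · have h4 := hmmax.lt hΛ
      exact Finset.mem_filter.2 ⟨Finset.mem_Ioo.2 ⟨h4.1, h4.2.1⟩, hmmax, hm⟩
    · intro h
      obtain ⟨t, ht, hgt⟩ := Finset.mem_image.1 h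
      obtain ⟨-, ht1, ht2⟩ := Finset.mem_filter.1 ht
      exact hgm t ht1 ht2.ge hgt

/-! ### Orderings of a finite type and their initial segments -/

section Orderings

variable {P : Type*} [Fintype P] {N : ℕ}

/-- The elements whose position in the ordering `O`, counted from `0`, is less than `j`. -/
def initialSegment (O : P ≃ Fin N) (j : ℕ) : Finset P :=
  Finset.univ.filter (fun x => (O x : ℕ) < j)

@[simp] theorem mem_initialSegment {O : P ≃ Fin N} {j : ℕ} {x : P} :
    x ∈ initialSegment O j ↔ (O x : ℕ) < j := by
  simp [initialSegment]

theorem initialSegment_mono (O : P ≃ Fin N) {i j : ℕ} (h : i ≤ j) :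
    initialSegment O i ⊆ initialSegment O j := fun x hx => by
  rw [mem_initialSegment] at hx ⊢
  omega

theorem card_initialSegment (O : P ≃ Fin N) {j : ℕ} (h : j ≤ N) :
    (initialSegment O j).card = j := by
  have h1 : (initialSegment O j).map O.toEmbedding =
      Finset.univ.filter (fun i : Fin N => (i : ℕ) < j) := by
    ext i
    simp only [Finset.mem_map, mem_initialSegment, Finset.mem_filter, Finset.mem_univ, true_and]
    constructor
    · rintro ⟨x, hx, rfl⟩
      exact hx
    · intro hi
      exact ⟨O.symm i, by simpa using hi, by simp⟩
  rw [← Finset.card_map O.toEmbedding, h1, Fin.card_filter_val_lt, min_eq_right h]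

/-- An injective function to `ℕ` orders its domain by its values. -/
theorem exists_equiv_lt_iff {Q : Type*} [Fintype Q] (f : Q → ℕ) (hf : Function.Injective f) :
    ∃ O : Q ≃ Fin (Fintype.card Q), ∀ x y, O x < O y ↔ f x < f y := by
  classical
  let s : Finset ℕ := Finset.univ.image f
  have hs : s.card = Fintype.card Q := Finset.card_image_of_injective _ hf
  let E : Q ≃ s := Equiv.ofBijective (fun x => ⟨f x, Finset.mem_image_of_mem f (Finset.mem_univ x)⟩)
    ⟨fun x y h => hf (congrArg Subtype.val h), fun ⟨y, hy⟩ => by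
      obtain ⟨x, -, hx⟩ := Finset.mem_image.1 hy
      exact ⟨x, Subtype.ext hx⟩⟩
  refine ⟨E.trans (s.orderIsoOfFin hs).symm.toEquiv, fun x y => ?_⟩
  exact (s.orderIsoOfFin hs).symm.lt_iff_lt

/-- Initial segments of the ordering by the values of `f` are sublevel sets of `f`. -/
theorem exists_lt_iff_lt {Q : Type*} [Fintype Q] {f : Q → ℕ} {M : ℕ} {O : Q ≃ Fin M}
    (hO : ∀ x y, O x < O y ↔ f x < f y) (t : ℕ) (ht : t ≤ M) :
    ∃ θ, ∀ x, (O x : ℕ) < t ↔ f x < θ := by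
  classical
  rcases ht.lt_or_eq with h | rfl
  · refine ⟨f (O.symm ⟨t, h⟩), fun x => ?_⟩
    rw [← hO, Equiv.apply_symm_apply, Fin.lt_def]
  · refine ⟨(Finset.univ.sup f) + 1, fun x => iff_of_true (O x).2 ?_⟩
    exact Nat.lt_succ_of_le (Finset.le_sup (Finset.mem_univ x))

end Orderings

/-! ### Cuts of odd connectivity -/

/-- A symmetric submodular function `κ` on the subsets of `P`, with the parity of the
cardinality, which attains its least value on nonempty proper subsets at `B`, this value being odd,
where `B` has several elements. The case in mind is the number of edges of a cut in a regular graph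
of odd degree with an edge-connectivity equal to the degree. -/
structure IsOddMinCut {P : Type*} [Fintype P] [DecidableEq P] (κ : Finset P → ℕ)
    (B : Finset P) : Prop where
  submod : ∀ S T, κ (S ∪ T) + κ (S ∩ T) ≤ κ S + κ T
  compl : ∀ S, κ Sᶜ = κ S
  parity : ∀ S, κ S % 2 = S.card % 2
  le : ∀ S : Finset P, S.Nonempty → S ≠ Finset.univ → κ B ≤ κ S
  odd : κ B % 2 = 1
  one_lt : 1 < B.card

namespace IsOddMinCut

variable {P : Type*} [Fintype P] [DecidableEq P] {κ : Finset P → ℕ} {B : Finset P}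

/-- Uncrossing a set with the minimal cut `B`. -/
theorem union_le (h : IsOddMinCut κ B) {S : Finset P} (h1 : (S ∩ B).Nonempty) (h2 : ¬ B ⊆ S) :
    κ (S ∪ B) ≤ κ S := by
  have h3 := h.submod S B
  have h4 := h.le (S ∩ B) h1 fun h5 => h2 fun x _ =>
    (Finset.mem_inter.1 (h5 ▸ Finset.mem_univ x)).1
  omega

theorem sdiff_le (h : IsOddMinCut κ B) {S : Finset P} (h1 : (S ∩ B).Nonempty) (h2 : ¬ B ⊆ S) :
    κ (S \ B) ≤ κ S := by
  have h3 : (S \ B)ᶜ = Sᶜ ∪ B := by ext x; simp; tauto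
  rw [← h.compl (S \ B), h3, ← h.compl S]
  refine h.union_le ?_ ?_
  · obtain ⟨x, hx, hxS⟩ := Finset.not_subset.1 h2
    exact ⟨x, by simp [hx, hxS]⟩
  · intro h4
    obtain ⟨x, hx⟩ := h1
    rw [Finset.mem_inter] at hx
    exact Finset.mem_compl.1 (h4 hx.2) hx.1

/-- By submodularity it suffices to add `b` to the complement of `B`, and there the minimality of
`κ B` and the parity apply. -/
theorem lt_insert (h : IsOddMinCut κ B) {S : Finset P} (hS : Disjoint S B) {b : P} (hb : b ∈ B) :
    κ S < κ (insert b S) := by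
  have hbS : b ∉ S := fun h1 => Finset.disjoint_left.1 hS h1 hb
  have h1 : insert b S ∪ Bᶜ = insert b Bᶜ := by
    ext x
    have := fun h3 : x ∈ S => Finset.disjoint_left.1 hS h3
    simp only [Finset.mem_union, Finset.mem_insert, Finset.mem_compl]
    tauto
  have h2 : insert b S ∩ Bᶜ = S := by
    ext x
    have := fun h3 : x ∈ S => Finset.disjoint_left.1 hS h3
    simp only [Finset.mem_inter, Finset.mem_insert, Finset.mem_compl]
    constructor
    · rintro ⟨rfl | h3, h4⟩
      · exact absurd hb h4
      · exact h3
    · exact fun h3 => ⟨Or.inr h3, this h3⟩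
  have h3 := h.submod (insert b S) Bᶜ
  rw [h1, h2, h.compl] at h3
  have h4 := h.le (insert b Bᶜ) ⟨b, Finset.mem_insert_self _ _⟩ fun h5 => by
    obtain ⟨x, hx, hxb⟩ := Finset.exists_mem_ne h.one_lt b
    have := h5 ▸ Finset.mem_univ x
    simp [hxb, hx] at this
  have h5 := h.parity S
  have h6 := h.parity (insert b S)
  rw [Finset.card_insert_of_notMem hbS] at h6
  omega

theorem lt_erase (h : IsOddMinCut κ B) {S : Finset P} (hS : B ⊆ S) {b : P} (hb : b ∈ B) :
    κ S < κ (S.erase b) := by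
  rw [← h.compl S, ← h.compl (S.erase b), Finset.compl_erase]
  refine h.lt_insert ?_ hb
  rw [Finset.disjoint_left]
  exact fun x hx hxB => Finset.mem_compl.1 hx (hS hxB)

theorem card_odd (h : IsOddMinCut κ B) : B.card % 2 = 1 := by
  rw [← h.parity, h.odd]

theorem sdiff_ne_union (h : IsOddMinCut κ B) (S : Finset P) : κ (S \ B) ≠ κ (S ∪ B) := by
  have h1 := h.parity (S \ B)
  have h2 := h.parity (S ∪ B)
  have h3 := Finset.card_sdiff_add_card S B
  have h4 := h.card_odd
  omega

/-- By submodularity the effect on `κ` of adding `B` decreases with the set outside of `B`. -/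
theorem union_lt_sdiff_mono (h : IsOddMinCut κ B) {S T : Finset P} (hST : S ⊆ T)
    (h1 : κ (S ∪ B) < κ (S \ B)) : κ (T ∪ B) < κ (T \ B) := by
  have h2 := h.submod (S ∪ B) (T \ B)
  have h3 : S ∪ B ∪ T \ B = T ∪ B := by
    ext x
    have := @hST x
    simp only [Finset.mem_union, Finset.mem_sdiff]
    tauto
  have h4 : (S ∪ B) ∩ (T \ B) = S \ B := by
    ext x
    have := @hST x
    simp only [Finset.mem_union, Finset.mem_sdiff, Finset.mem_inter]
    tauto
  rw [h3, h4] at h2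
  omega

end IsOddMinCut

/-- The choice of the height `j₀` at which to pass from a sequence `L` to a sequence `U`, both of
which lie below a sequence `Λ` without plateaus between `p` and `q`, so that they stay strictly
below the largest value of `Λ` there. -/
theorem exists_switch {Λ L U : ℕ → ℕ} {p q : ℕ} (hpq : p + 1 < q)
    (hL : ∀ j, p < j → j < q → L j ≤ Λ j) (hU : ∀ j, p < j → j < q → U j ≤ Λ j)
    (hp : Λ p < Λ (p + 1)) (hq : Λ q < Λ (q - 1))
    (hLp : L p = Λ p) (hLp' : L (p + 1) = Λ p) (hUq : U q = Λ q) (hUq' : U (q - 1) = Λ q)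
    (hne : ∀ j, L j ≠ U j) (hmono : ∀ i j, i ≤ j → U i < L i → U j < L j)
    (hΛ : ∀ j, p < j → j < q → Λ j ≠ Λ (j + 1)) :
    ∃ j₀ m, p < j₀ ∧ j₀ < q ∧ p < m ∧ m < q ∧ (∀ j, p ≤ j → j ≤ q → Λ j ≤ Λ m) ∧
      (∀ j, p ≤ j → j ≤ j₀ → L j < Λ m) ∧ (∀ j, j₀ ≤ j → j ≤ q → U j < Λ m) := by
  obtain ⟨m, hm, hmax⟩ := Finset.exists_max_image (Finset.Ioo p q) Λ ⟨p + 1, by simp; omega⟩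
  rw [Finset.mem_Ioo] at hm
  have hmax' : ∀ j, p < j → j < q → Λ j ≤ Λ m := fun j h1 h2 => hmax j (Finset.mem_Ioo.2 ⟨h1, h2⟩)
  have hpm : Λ p < Λ m := hp.trans_le (hmax' _ (by omega) (by omega))
  have hqm : Λ q < Λ m := hq.trans_le (hmax' _ (by omega) (by omega))
  have hLU : ∀ j, p < j → j < q → ¬ U j < L j → L j < Λ m := fun j h1 h2 h3 => by
    have := hne j
    have := hU j h1 h2
    have := hmax' j h1 h2
    omega
  have hUL : ∀ j, p < j → j ≤ q → U j < L j → U j < Λ m := fun j h1 h2 h3 => by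
    rcases h2.lt_or_eq with h2 | rfl
    · have := hL j h1 h2
      have := hmax' j h1 h2
      omega
    · omega
  -- `j₁` is the first height at which `U` lies below `L`, or else `q - 1`
  have hex : ∃ j, p < j ∧ (q - 1 ≤ j ∨ U j < L j) := ⟨q - 1, by omega, Or.inl le_rfl⟩
  obtain ⟨j₁, ⟨h1, h2⟩, hmin⟩ : ∃ j₁, (p < j₁ ∧ (q - 1 ≤ j₁ ∨ U j₁ < L j₁)) ∧
      ∀ j < j₁, ¬ (p < j ∧ (q - 1 ≤ j ∨ U j < L j)) := by
    classical
    exact ⟨Nat.find hex, Nat.find_spec hex, fun j hj => Nat.find_min hex hj⟩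
  have h3 : j₁ ≤ q - 1 := by
    by_contra h
    exact hmin (q - 1) (by omega) ⟨by omega, Or.inl le_rfl⟩
  have hlow : ∀ j, p ≤ j → j < j₁ → L j < Λ m := fun j h4 h5 => by
    rcases h4.lt_or_eq with h4 | rfl
    · exact hLU j h4 (by omega) fun h6 => hmin j h5 ⟨h4, Or.inr h6⟩
    · omega
  have hall : ∀ j, p ≤ j → j ≤ q → Λ j ≤ Λ m := fun j h4 h5 => by
    rcases h4.lt_or_eq with h4 | rfl
    · rcases h5.lt_or_eq with h5 | rfl
      · exact hmax' j h4 h5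
      · exact hqm.le
    · exact hpm.le
  by_cases hB : U j₁ < L j₁
  · have hhigh : ∀ j, j₁ ≤ j → j ≤ q → U j < Λ m := fun j h4 h5 =>
      hUL j (by omega) h5 (hmono j₁ j h4 hB)
    by_cases hc : L j₁ < Λ m
    · refine ⟨j₁, m, h1, by omega, hm.1, hm.2, hall, fun j h4 h5 => ?_, hhigh⟩
      rcases h5.lt_or_eq with h5 | rfl
      · exact hlow j h4 h5
      · exact hc
    · -- `Λ` attains its largest value at `j₁`, hence not at `j₁ - 1`
      have h4 : j₁ ≠ p + 1 := fun h => hc (by rw [h]; omega)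
      have h5 := hL j₁ h1 (by omega)
      have h6 := hmax' j₁ h1 (by omega)
      have h7 := hΛ (j₁ - 1) (by omega) (by omega)
      rw [Nat.sub_add_cancel (by omega)] at h7
      have h8 := hmax' (j₁ - 1) (by omega) (by omega)
      have h9 := hU (j₁ - 1) (by omega) (by omega)
      refine ⟨j₁ - 1, m, by omega, by omega, hm.1, hm.2, hall,
        fun j h10 h11 => hlow j h10 (by omega), fun j h10 h11 => ?_⟩
      by_cases h12 : j = j₁ - 1
      · subst h12
        omega
      · exact hhigh j (by omega) h11
  · have h4 : j₁ = q - 1 := by omega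
    refine ⟨j₁, m, h1, by omega, hm.1, hm.2, hall, fun j h5 h6 => ?_, fun j h5 h6 => ?_⟩
    · rcases h6.lt_or_eq with h6 | rfl
      · exact hlow j h5 h6
      · exact hLU j h1 (by omega) hB
    · rcases h6.lt_or_eq with h6 | rfl
      · rw [show j = q - 1 by omega]
        omega
      · omega

/-! ### Contracting one side of an odd minimal cut -/

section Contraction

variable {P Q : Type*} [Fintype P] [DecidableEq P] [DecidableEq Q]
  {B : Finset P} {π : P → Q} {c : Q}

/-- Let `π` contract `B` to the point `c`. Outside of `B` and `c` it preserves cardinalities. -/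
theorem card_filter_apply_mem (hB : ∀ x, x ∈ B ↔ π x = c) (hπ : Function.Surjective π)
    (hinj : ∀ x y, π x = π y → π x ≠ c → x = y) (T : Finset Q) :
    ((Finset.univ.filter (fun x => π x ∈ T)) \ B).card = (T.erase c).card := by
  have h1 : ((Finset.univ.filter (fun x => π x ∈ T)) \ B).image π = T.erase c := by
    ext z
    simp only [Finset.mem_image, Finset.mem_sdiff, Finset.mem_filter, Finset.mem_univ, true_and,
      Finset.mem_erase, hB]
    constructor
    · rintro ⟨x, ⟨h2, h3⟩, rfl⟩
      exact ⟨h3, h2⟩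
    · rintro ⟨h2, h3⟩
      obtain ⟨x, rfl⟩ := hπ z
      exact ⟨x, ⟨h3, h2⟩, rfl⟩
  rw [← h1, Finset.card_image_of_injOn]
  intro x hx y _ hxy
  refine hinj x y hxy fun h => ?_
  exact (Finset.mem_sdiff.1 (Finset.mem_coe.1 hx)).2 ((hB x).2 h)

/-- Let the side `B` of an odd minimal cut be contracted to a point `c`. Then every ordering of `P`
gives rise to an ordering of the contraction of smaller width. -/
theorem IsOddMinCut.exists_sequenceWidth_lt [Fintype Q] {κ : Finset P → ℕ} (h : IsOddMinCut κ B)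
    (hB : ∀ x, x ∈ B ↔ π x = c) (hπ : Function.Surjective π)
    (hinj : ∀ x y, π x = π y → π x ≠ c → x = y) {N N' : ℕ} (O : P ≃ Fin N)
    (hN' : Fintype.card Q = N') :
    ∃ O' : Q ≃ Fin N',
      sequenceWidth (fun t => (κ (Finset.univ.filter (fun x => π x ∈ initialSegment O' t)) : ℝ≥0))
        N' <
      sequenceWidth (fun j => (κ (initialSegment O j) : ℝ≥0)) N := by
  set S : ℕ → Finset P := initialSegment O with hS
  -- the elements of `B` lie at the heights from `p` to `q`, where `O b₀ = p` and `O b₁ + 1 = q`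
  have hBne : B.Nonempty := Finset.card_pos.1 (by have := h.one_lt; omega)
  obtain ⟨b₀, hb₀, hmin⟩ := Finset.exists_min_image B (fun x => (O x : ℕ)) hBne
  obtain ⟨b₁, hb₁, hmax⟩ := Finset.exists_max_image B (fun x => (O x : ℕ)) hBne
  obtain ⟨p, hp⟩ : ∃ p, (O b₀ : ℕ) = p := ⟨_, rfl⟩
  obtain ⟨q, hq⟩ : ∃ q, (O b₁ : ℕ) + 1 = q := ⟨_, rfl⟩
  have hqN : q ≤ N := by have := (O b₁).2; omega
  have hpq : p + 1 < q := by
    obtain ⟨b, hb, hbb⟩ := Finset.exists_mem_ne h.one_lt b₀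
    have h1 : (O b : ℕ) ≠ O b₀ := fun h1 => hbb (O.injective (Fin.ext h1))
    have h2 := hmin b hb
    have h3 := hmax b hb
    omega
  have hSp : ∀ j ≤ p, Disjoint (S j) B := fun j hj => by
    rw [Finset.disjoint_left]
    intro x hx hxB
    have h1 := hmin x hxB
    rw [hS, mem_initialSegment] at hx
    omega
  have hSq : ∀ j, q ≤ j → B ⊆ S j := fun j hj x hxB => by
    have h1 := hmax x hxB
    rw [hS, mem_initialSegment]
    omega
  have hS_inter : ∀ j, p < j → (S j ∩ B).Nonempty := fun j hj =>
    ⟨b₀, Finset.mem_inter.2 ⟨mem_initialSegment.2 (by omega), hb₀⟩⟩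
  have hS_not : ∀ j, j < q → ¬ B ⊆ S j := fun j hj hsub => by
    have := mem_initialSegment.1 (hsub hb₁)
    omega
  have hS_card : ∀ j ≤ N, (S j).card = j := fun j hj => card_initialSegment O hj
  have hSmono : ∀ i j, i ≤ j → S i ⊆ S j := fun i j hij => initialSegment_mono O hij
  have hSp1 : S (p + 1) = insert b₀ (S p) := by
    ext x
    rw [Finset.mem_insert, hS, mem_initialSegment, mem_initialSegment, ← hp,
      ← O.injective.eq_iff, Fin.ext_iff]
    omega
  have hSq1 : S (q - 1) = (S q).erase b₁ := by
    ext x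
    rw [Finset.mem_erase, hS, mem_initialSegment, mem_initialSegment, ← hq,
      Ne, ← O.injective.eq_iff, Fin.ext_iff]
    omega
  have hL : ∀ j ≤ p, S j \ B = S j := fun j hj => Finset.sdiff_eq_self_of_disjoint (hSp j hj)
  have hU : ∀ j, q ≤ j → S j ∪ B = S j := fun j hj => Finset.union_eq_left.2 (hSq j hj)
  have hLp1 : S (p + 1) \ B = S p := by
    rw [hSp1, Finset.insert_sdiff_of_mem _ hb₀, hL p le_rfl]
  have hUq1 : S (q - 1) ∪ B = S q := by
    rw [hSq1]
    ext x
    have := @hSq q le_rfl x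
    simp only [Finset.mem_union, Finset.mem_erase]
    by_cases hx : x = b₁
    · subst hx; tauto
    · tauto
  have hΛne : ∀ j < N, κ (S j) ≠ κ (S (j + 1)) := fun j hj hjj => by
    have h1 := h.parity (S j)
    have h2 := h.parity (S (j + 1))
    rw [hS_card _ (by omega)] at h1 h2
    omega
  obtain ⟨j₀, m, hj0, hj0q, hpm, hmq, hmaxΛ, hlow, hhigh⟩ :=
    exists_switch (Λ := fun j => κ (S j)) (L := fun j => κ (S j \ B)) (U := fun j => κ (S j ∪ B))
      hpq (fun j h1 h2 => h.sdiff_le (hS_inter j h1) (hS_not j h2))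
      (fun j h1 h2 => h.union_le (hS_inter j h1) (hS_not j h2))
      (by simpa only [hSp1] using h.lt_insert (hSp p le_rfl) hb₀)
      (by simpa only [hSq1] using h.lt_erase (hSq q le_rfl) hb₁)
      (by simp only [hL p le_rfl]) (by simp only [hLp1]) (by simp only [hU q le_rfl])
      (by simp only [hUq1]) (fun j => h.sdiff_ne_union _)
      (fun i j hij => h.union_lt_sdiff_mono (hSmono i j hij)) (fun j _ h2 => hΛne j (by omega))
  -- the ordering in which `c` comes between the heights `j₀ - 1` and `j₀` of `O`
  let f : Q → ℕ := fun z => if z = c then 2 * j₀ - 1 else 2 * O (Function.surjInv hπ z)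
  have hfc : f c = 2 * j₀ - 1 := if_pos rfl
  have hfx : ∀ x, x ∉ B → f (π x) = 2 * O x := fun x hx => by
    have h1 : π x ≠ c := fun h1 => hx ((hB x).2 h1)
    have h2 : Function.surjInv hπ (π x) = x :=
      (hinj x _ (Function.surjInv_eq hπ (π x)).symm h1).symm
    change (if π x = c then _ else _) = _
    rw [if_neg h1, h2]
  have hf : Function.Injective f := by
    intro z w hzw
    obtain ⟨x, rfl⟩ := hπ z
    obtain ⟨y, rfl⟩ := hπ w
    by_cases hx : x ∈ B <;> by_cases hy : y ∈ B
    · rw [(hB x).1 hx, (hB y).1 hy]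
    · rw [(hB x).1 hx, hfc, hfx y hy] at hzw
      omega
    · rw [(hB y).1 hy, hfc, hfx x hx] at hzw
      omega
    · rw [hfx x hx, hfx y hy] at hzw
      rw [O.injective (Fin.ext (show (O x : ℕ) = O y by omega))]
  obtain ⟨O', hO'⟩ : ∃ O' : Q ≃ Fin N', ∀ x y, O' x < O' y ↔ f x < f y :=
    hN' ▸ exists_equiv_lt_iff f hf
  refine ⟨O', ?_⟩
  set E : ℕ → Finset P :=
    fun t => Finset.univ.filter (fun x => π x ∈ initialSegment O' t) with hE
  have hBcard := h.one_lt
  have hBodd := h.card_odd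
  obtain ⟨k, hk⟩ : ∃ k, B.card = k + 1 := ⟨B.card - 1, by omega⟩
  have hcard : N = N' + k := by
    have h1 := card_filter_apply_mem hB hπ hinj Finset.univ
    have h2 := Finset.card_sdiff_add_card (Finset.univ : Finset P) B
    have h3 : Fintype.card P = N := by rw [Fintype.card_congr O, Fintype.card_fin]
    simp only [Finset.mem_univ, Finset.filter_true, Finset.card_erase_of_mem,
      Finset.union_eq_left.2 (Finset.subset_univ B), Finset.card_univ, h3, hN'] at h1 h2
    have h4 : 0 < N' := hN' ▸ Fintype.card_pos_iff.2 ⟨c⟩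
    omega
  subst hcard
  have hEt : ∀ t ≤ N', ∃ j ≤ N' + k, (j ≤ j₀ ∧ E t = S j \ B ∧ t = (S j \ B).card) ∨
      (j₀ ≤ j ∧ E t = S j ∪ B ∧ t + k = (S j ∪ B).card) := by
    intro t ht
    obtain ⟨θ, hθ⟩ := exists_lt_iff_lt hO' t ht
    have hx : ∀ x, x ∉ B → (x ∈ E t ↔ x ∈ S (min ((θ + 1) / 2) (N' + k))) := fun x hx => by
      have := (O x).2
      rw [hE, Finset.mem_filter, mem_initialSegment, hθ, hfx x hx, hS, mem_initialSegment]
      simp only [Finset.mem_univ, true_and]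
      omega
    have hxB : ∀ x, x ∈ B → (x ∈ E t ↔ 2 * j₀ - 1 < θ) := fun x hx => by
      rw [hE, Finset.mem_filter, mem_initialSegment, hθ, (hB x).1 hx, hfc]
      simp only [Finset.mem_univ, true_and]
    have hcard := card_filter_apply_mem hB hπ hinj (initialSegment O' t)
    change (E t \ B).card = _ at hcard
    refine ⟨min ((θ + 1) / 2) (N' + k), min_le_right _ _, ?_⟩
    by_cases hcθ : 2 * j₀ - 1 < θ
    · right
      have h1 : E t = S (min ((θ + 1) / 2) (N' + k)) ∪ B := by
        ext x
        rw [Finset.mem_union]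
        by_cases hxB' : x ∈ B
        · simp [hxB x hxB', hxB', hcθ]
        · simp [hx x hxB', hxB']
      refine ⟨by omega, h1, ?_⟩
      rw [Finset.card_erase_of_mem (mem_initialSegment.2 ((hθ c).2 (hfc ▸ hcθ))),
        card_initialSegment O' ht] at hcard
      have h2 := Finset.card_sdiff_add_card (E t) B
      have h3 : (E t ∪ B) = E t := by
        rw [h1, Finset.union_assoc, Finset.union_self]
      have h4 : 0 < t := by
        have := (hθ c).2 (hfc ▸ hcθ)
        omega
      rw [h3, hcard] at h2
      rw [← h1]
      omega
    · left
      have h1 : E t = S (min ((θ + 1) / 2) (N' + k)) \ B := by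
        ext x
        rw [Finset.mem_sdiff]
        by_cases hxB' : x ∈ B
        · simp [hxB x hxB', hxB', hcθ]
        · simp [hx x hxB', hxB']
      refine ⟨by omega, h1, ?_⟩
      rw [Finset.erase_eq_of_notMem fun h2 =>
        hcθ (hfc ▸ (hθ c).1 (mem_initialSegment.1 h2)), card_initialSegment O' ht, h1,
        Finset.sdiff_idem] at hcard
      exact hcard.symm
  have hle_sdiff : ∀ i j, i ≤ j → S i \ B ⊆ S j \ B := fun i j hij =>
    Finset.sdiff_subset_sdiff (hSmono i j hij) le_rfl
  have hle_union : ∀ i j, i ≤ j → S i ∪ B ⊆ S j ∪ B := fun i j hij =>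
    Finset.union_subset_union (hSmono i j hij) le_rfl
  have hpc : (S p \ B).card = p := by rw [hL p le_rfl, hS_card p (by omega)]
  have hpc' : (S p ∪ B).card = p + k + 1 := by
    rw [Finset.card_union_of_disjoint (hSp p le_rfl), hS_card p (by omega), hk, add_assoc]
  have hqc : (S q ∪ B).card = q := by rw [hU q le_rfl, hS_card q (by omega)]
  have hqc' : (S q \ B).card + k + 1 = q := by
    have := Finset.card_sdiff_add_card (S q) B
    omega
  have hpN : p + k + 1 ≤ q := hpc' ▸ hqc ▸ Finset.card_le_card (hle_union p q (by omega))
  refine sequenceWidth_lt (p := p) (m := m) (q := q) (c := (κ (S m) : ℝ≥0)) hpm hmq hqN ?_ ?_ ?_ ?_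
    ?_ rfl ?_
  · exact fun j hj => Nat.cast_injective.ne (hΛne j hj)
  · intro t ht
    have hpar : ∀ s ≤ N', κ (E s) % 2 = s % 2 := fun s hs => by
      rw [h.parity]
      obtain ⟨j, -, ⟨-, h1, h2⟩ | ⟨-, h1, h2⟩⟩ := hEt s hs <;> rw [h1, ← h2]
      omega
    refine Nat.cast_injective.ne fun (h1 : κ (E t) = κ (E (t + 1))) => ?_
    have h2 := hpar t (by omega)
    have h3 := hpar (t + 1) (by omega)
    omega
  · intro t ht
    obtain ⟨j, hjN, ⟨h1, h2, h3⟩ | ⟨h1, h2, h3⟩⟩ := hEt t (by omega)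
    · have h4 : E t = S t := by
        rcases le_or_gt j p with hj | hj
        · rw [hL j hj, hS_card j hjN] at h3
          rw [h2, hL j hj, h3]
        · have h5 := Finset.card_le_card (hle_sdiff p j hj.le)
          obtain rfl : t = p := by omega
          rw [h2, ← hL t le_rfl]
          exact (Finset.eq_of_subset_of_card_le (hle_sdiff t j hj.le) (by omega)).symm
      change ((κ (E t) : ℕ) : ℝ≥0) = _
      rw [h4]
    · have h5 := Finset.card_le_card (hle_union p j (by omega))
      omega
  · intro t ht htq
    obtain ⟨j, hjN, ⟨h1, h2, h3⟩ | ⟨h1, h2, h3⟩⟩ := hEt t ht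
    · have h5 := Finset.card_le_card (hle_sdiff j q (by omega))
      omega
    · have h4 : E t = S (t + k) := by
        rcases lt_or_ge j q with hj | hj
        · have h5 := Finset.card_le_card (hle_union j q hj.le)
          have h6 : t + k = q := by omega
          rw [h2, h6, ← hU q le_rfl]
          exact Finset.eq_of_subset_of_card_le (hle_union j q hj.le) (by omega)
        · rw [hU j hj, hS_card j hjN] at h3
          rw [h2, hU j hj, h3]
      change ((κ (E t) : ℕ) : ℝ≥0) = _
      rw [h4]
  · intro t hpt htq
    obtain ⟨j, hjN, ⟨h1, h2, h3⟩ | ⟨h1, h2, h3⟩⟩ := hEt t (by omega)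
    · have h5 : (S j \ B).card ≤ (S j).card := Finset.card_le_card Finset.sdiff_subset
      rw [hS_card j hjN] at h5
      change ((κ (E t) : ℕ) : ℝ≥0) < _
      rw [h2]
      exact Nat.cast_lt.2 (hlow j (by omega) h1)
    · have h5 : (S j).card ≤ (S j ∪ B).card := Finset.card_le_card Finset.subset_union_left
      rw [hS_card j hjN] at h5
      change ((κ (E t) : ℕ) : ℝ≥0) < _
      rw [h2]
      exact Nat.cast_lt.2 (hhigh j h1 (by omega))
  · exact fun j h1 h2 => Nat.cast_le.2 (hmaxΛ j h1 h2)

end Contraction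

/-! ### Cuts in an incidence structure -/

section Cut

variable {Φ P : Type*} {𝓕 : Finset Φ} {r : Φ → P → Prop}

/-- The elements of `𝓕` which are incident, with respect to `r`, both to an element of `S` and to an
element outside of `S`. -/
noncomputable def cut (𝓕 : Finset Φ) (r : Φ → P → Prop) (S : Finset P) : Finset Φ :=
  open Classical in
  𝓕.filter (fun F => (∃ x ∈ S, r F x) ∧ ∃ x, x ∉ S ∧ r F x)

theorem mem_cut {S : Finset P} {F : Φ} :
    F ∈ cut 𝓕 r S ↔ F ∈ 𝓕 ∧ (∃ x ∈ S, r F x) ∧ ∃ x, x ∉ S ∧ r F x := by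
  simp [cut]

theorem cut_empty : cut 𝓕 r ∅ = ∅ := by
  ext F
  simp [mem_cut]

variable [DecidableEq P]

theorem cut_compl [Fintype P] (S : Finset P) : cut 𝓕 r Sᶜ = cut 𝓕 r S := by
  ext F
  simp only [mem_cut, Finset.mem_compl, not_not]
  tauto

/-- The size of a cut is a submodular function. -/
theorem card_cut_union_add_card_cut_inter_le (S T : Finset P) :
    (cut 𝓕 r (S ∪ T)).card + (cut 𝓕 r (S ∩ T)).card ≤ (cut 𝓕 r S).card + (cut 𝓕 r T).card := by
  classical
  rw [← Finset.card_union_add_card_inter, ← Finset.card_union_add_card_inter (cut 𝓕 r S)]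
  refine add_le_add (Finset.card_le_card fun F hF => ?_) (Finset.card_le_card fun F hF => ?_)
  · simp only [Finset.mem_union, Finset.mem_inter, mem_cut] at hF ⊢
    rcases hF with ⟨hF, ⟨x, hx, hxF⟩, ⟨y, hy, hyF⟩⟩ | ⟨hF, ⟨x, hx, hxF⟩, ⟨y, hy, hyF⟩⟩
    · rw [not_or] at hy
      exact hx.imp (fun hx => ⟨hF, ⟨x, hx, hxF⟩, ⟨y, hy.1, hyF⟩⟩)
        (fun hx => ⟨hF, ⟨x, hx, hxF⟩, ⟨y, hy.2, hyF⟩⟩)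
    · rw [not_and_or] at hy
      exact hy.imp (fun hy => ⟨hF, ⟨x, hx.1, hxF⟩, ⟨y, hy, hyF⟩⟩)
        (fun hy => ⟨hF, ⟨x, hx.2, hxF⟩, ⟨y, hy, hyF⟩⟩)
  · simp only [Finset.mem_union, Finset.mem_inter, mem_cut] at hF ⊢
    obtain ⟨⟨hF, -, ⟨y, hy, hyF⟩⟩, ⟨-, ⟨x, hx, hxF⟩, -⟩⟩ := hF
    rw [not_or] at hy
    exact ⟨⟨hF, ⟨x, hx.1, hxF⟩, ⟨y, hy.1, hyF⟩⟩, ⟨hF, ⟨x, hx.2, hxF⟩, ⟨y, hy.2, hyF⟩⟩⟩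

open Classical in
/-- If every `F ∈ 𝓕` is incident to exactly two elements, then moving `x` to the other side of a cut
exchanges the cut and the uncut among those `F` which are incident to `x`. -/
theorem card_cut_insert_mod_two (h2 : ∀ F ∈ 𝓕, ∃ x y, x ≠ y ∧ ∀ z, r F z ↔ z = x ∨ z = y)
    {S : Finset P} {x : P} (hx : x ∉ S) :
    (cut 𝓕 r (insert x S)).card % 2 =
      ((cut 𝓕 r S).card + (𝓕.filter (fun F => r F x)).card) % 2 := by
  have h3 : (cut 𝓕 r (insert x S)).filter (fun F => ¬ r F x) =
      (cut 𝓕 r S).filter (fun F => ¬ r F x) := by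
    ext F
    simp only [Finset.mem_filter, mem_cut, Finset.mem_insert]
    refine and_congr_left fun hF => and_congr_right fun _ => and_congr ?_ ?_
    · exact exists_congr fun y => ⟨fun h => ⟨h.1.resolve_left fun e => hF (e ▸ h.2), h.2⟩,
        fun h => ⟨Or.inr h.1, h.2⟩⟩
    · exact exists_congr fun y => ⟨fun h => ⟨fun h4 => h.1 (Or.inr h4), h.2⟩,
        fun h => ⟨fun h4 => h4.elim (fun e => hF (e ▸ h.2)) h.1, h.2⟩⟩
  have h4 : (cut 𝓕 r (insert x S)).filter (fun F => r F x) =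
      (𝓕.filter (fun F => r F x)) \ (cut 𝓕 r S).filter (fun F => r F x) := by
    ext F
    simp only [Finset.mem_filter, Finset.mem_sdiff, mem_cut, Finset.mem_insert]
    by_cases hF : F ∈ 𝓕
    · by_cases hFx : r F x
      · obtain ⟨y, hyx, h⟩ : ∃ y, y ≠ x ∧ ∀ z, r F z ↔ z = x ∨ z = y := by
          obtain ⟨a, b, hab, h⟩ := h2 F hF
          rcases (h x).1 hFx with rfl | rfl
          · exact ⟨b, hab.symm, h⟩
          · exact ⟨a, hab, fun z => (h z).trans or_comm⟩
        simp only [h]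
        grind
      · simp [hFx]
    · simp [hF]
  have h5 : (cut 𝓕 r S).filter (fun F => r F x) ⊆ 𝓕.filter (fun F => r F x) := fun F hF => by
    rw [Finset.mem_filter, mem_cut] at hF
    exact Finset.mem_filter.2 ⟨hF.1.1, hF.2⟩
  have h6 := Finset.card_filter_add_card_filter_not (s := cut 𝓕 r S) (fun F => r F x)
  have h7 := Finset.card_filter_add_card_filter_not (s := cut 𝓕 r (insert x S)) (fun F => r F x)
  have h8 := Finset.card_le_card h5
  rw [h3, h4, Finset.card_sdiff_of_subset h5] at h7
  omega

open Classical in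
theorem card_cut_mod_two (h2 : ∀ F ∈ 𝓕, ∃ x y, x ≠ y ∧ ∀ z, r F z ↔ z = x ∨ z = y) {d : ℕ}
    (hd : ∀ x, (𝓕.filter (fun F => r F x)).card % 2 = d % 2) (S : Finset P) :
    (cut 𝓕 r S).card % 2 = (S.card * d) % 2 := by
  induction S using Finset.induction_on with
  | empty => simp [cut_empty]
  | insert x S hx ih =>
    rw [card_cut_insert_mod_two h2 hx, Finset.card_insert_of_notMem hx, add_mul, one_mul,
      Nat.add_mod, ih, hd, ← Nat.add_mod]

end Cut

/-! ### Edge-connectivity of pseudomanifolds -/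

section Pseudomanifold

variable {V : Type*} {K : FiniteComplex V} {n : ℕ}

theorem mem_bricks {T : Finset V} : T ∈ K.bricks n ↔ T ∈ K.faces ∧ T.card = n + 1 := by
  simp [bricks]

theorem mem_facets {F : Finset V} : F ∈ K.facets n ↔ F ∈ K.faces ∧ F.card = n := by
  simp [facets]

theorem mem_facets_of_subset (hn : 0 < n) {T F : Finset V} (hT : T ∈ K.bricks n) (hFT : F ⊆ T)
    (hF : F.card = n) : F ∈ K.facets n :=
  mem_facets.2 ⟨(K.isRelLowerSet_faces (mem_bricks.1 hT).1).2 hFT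
    (Finset.card_pos.1 (hF ▸ hn)), hF⟩

/-- The facets which separate the bricks in `S` from the other ones. -/
noncomputable def facetCut (K : FiniteComplex V) (n : ℕ) (S : Finset {T // T ∈ K.bricks n}) :
    Finset (Finset V) :=
  cut (K.facets n) (fun F T => F ⊆ T.1) S

theorem width_le_orderingWidth (K : FiniteComplex V) (ω : Finset V → ℝ≥0)
    (O : K.Ordering n) : K.width n ω ≤ K.orderingWidth n ω O := by
  classical
  exact Finset.inf'_le _ (Finset.mem_univ O)

theorem exists_width_eq_orderingWidth (K : FiniteComplex V) (n : ℕ)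
    (ω : Finset V → ℝ≥0) : ∃ O : K.Ordering n, K.width n ω = K.orderingWidth n ω O := by
  classical
  obtain ⟨O, -, h⟩ := Finset.exists_mem_eq_inf' (s := (Finset.univ : Finset (K.Ordering n)))
    ⟨(K.bricks n).equivFin, Finset.mem_univ _⟩ (K.orderingWidth n ω)
  exact ⟨O, h⟩

theorem orderingWidth_one (O : K.Ordering n) :
    K.orderingWidth n (fun _ => 1) O =
      sequenceWidth (fun j => ((K.facetCut n (initialSegment O j)).card : ℝ≥0))
        (K.bricks n).card := by
  have h : K.levelWeight n (fun _ => 1) O =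
      fun j => ((K.facetCut n (initialSegment O j)).card : ℝ≥0) := by
    funext j
    have : K.levelSet n O j = K.facetCut n (initialSegment O j) := by
      ext F
      simp [levelSet, facetCut, mem_cut]
    simp [levelWeight, this]
  rw [← h]
  rfl

theorem incident_two_of_exists_two_bricks
    (h2 : ∀ F ∈ K.facets n, ∃ T ∈ K.bricks n, ∃ T' ∈ K.bricks n,
      T ≠ T' ∧ ∀ U ∈ K.bricks n, F ⊆ U ↔ U = T ∨ U = T') :
    ∀ F ∈ K.facets n, ∃ x y : {T // T ∈ K.bricks n}, x ≠ y ∧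
      ∀ z : {T // T ∈ K.bricks n}, F ⊆ z.1 ↔ z = x ∨ z = y := fun F hF => by
  obtain ⟨T, hT, T', hT', hne, h⟩ := h2 F hF
  refine ⟨⟨T, hT⟩, ⟨T', hT'⟩, fun e => hne (congrArg Subtype.val e), fun z => ?_⟩
  rw [h z.1 z.2, Subtype.ext_iff, Subtype.ext_iff]

variable [DecidableEq V]

theorem card_filter_facets_subset (hn : 0 < n) {T : Finset V} (hT : T ∈ K.bricks n) :
    ((K.facets n).filter (fun F => F ⊆ T)).card = n + 1 := by
  have : (K.facets n).filter (fun F => F ⊆ T) = T.powersetCard n := by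
    ext F
    rw [Finset.mem_filter, Finset.mem_powersetCard]
    exact ⟨fun h => ⟨h.2, (mem_facets.1 h.1).2⟩,
      fun h => ⟨mem_facets_of_subset hn hT h.1 h.2, h.1⟩⟩
  rw [this, Finset.card_powersetCard, (mem_bricks.1 hT).2, Nat.choose_succ_self_right]

/-- A brick has exactly two facets which contain a given `(n - 2)`-dimensional face of it. -/
theorem card_filter_facets_between (hn : 0 < n) {T R : Finset V} (hT : T ∈ K.bricks n)
    (hR : R.card + 1 = n) :
    (((K.facets n).filter (fun F => R ⊆ F)).filter (fun F => F ⊆ T)).card % 2 = 0 := by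
  by_cases hRT : R ⊆ T
  · have : ((K.facets n).filter (fun F => R ⊆ F)).filter (fun F => F ⊆ T) =
        (T \ R).image (fun v => insert v R) := by
      ext F
      simp only [Finset.mem_filter, Finset.mem_image, Finset.mem_sdiff]
      constructor
      · rintro ⟨⟨hF, hRF⟩, hFT⟩
        have h1 : (F \ R).card = 1 := by
          rw [Finset.card_sdiff_of_subset hRF, (mem_facets.1 hF).2]
          omega
        obtain ⟨v, hv⟩ := Finset.card_eq_one.1 h1
        have h2 : v ∈ F \ R := hv ▸ Finset.mem_singleton_self v
        rw [Finset.mem_sdiff] at h2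
        refine ⟨v, ⟨hFT h2.1, h2.2⟩, ?_⟩
        rw [← Finset.sdiff_union_of_subset hRF, hv, Finset.singleton_union]
      · rintro ⟨v, ⟨hvT, hvR⟩, rfl⟩
        have hsub : insert v R ⊆ T := Finset.insert_subset hvT hRT
        exact ⟨⟨mem_facets_of_subset hn hT hsub
          (by rw [Finset.card_insert_of_notMem hvR, hR]), Finset.subset_insert v R⟩, hsub⟩
    rw [this, Finset.card_image_of_injOn, Finset.card_sdiff_of_subset hRT, (mem_bricks.1 hT).2]
    · omega
    · intro v hv w _ hvw
      have hv' := (Finset.mem_sdiff.1 (Finset.mem_coe.1 hv)).2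
      have : v ∈ insert w R := (show insert v R = insert w R from hvw) ▸ Finset.mem_insert_self v R
      exact (Finset.mem_insert.1 this).resolve_right hv'
  · rw [Finset.card_eq_zero.2]
    refine Finset.filter_eq_empty_iff.2 fun F hF hFT => hRT ?_
    exact (Finset.mem_filter.1 hF).2.trans hFT

theorem IsPseudomanifold.exists_other_brick (hK : K.IsPseudomanifold n) {F T : Finset V}
    (hF : F ∈ K.facets n) (hT : T ∈ K.bricks n) (hFT : F ⊆ T) :
    ∃ T' ∈ K.bricks n, T' ≠ T ∧ ∀ U ∈ K.bricks n, F ⊆ U ↔ U = T ∨ U = T' := by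
  have h1 := hK.two_bricks F hF
  have h2 : T ∈ (K.bricks n).filter (fun T => F ⊆ T) := Finset.mem_filter.2 ⟨hT, hFT⟩
  have h3 : (((K.bricks n).filter (fun T => F ⊆ T)).erase T).card = 1 := by
    rw [Finset.card_erase_of_mem h2, h1]
  obtain ⟨T', hT'⟩ := Finset.card_eq_one.1 h3
  have h4 : ∀ U, U ≠ T ∧ U ∈ K.bricks n ∧ F ⊆ U ↔ U = T' := fun U => by
    rw [← Finset.mem_singleton, ← hT', Finset.mem_erase, Finset.mem_filter]
  obtain ⟨h5, h6, h7⟩ := (h4 T').2 rfl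
  refine ⟨T', h6, h5, fun U hU => ⟨fun h => ?_, ?_⟩⟩
  · by_cases hUT : U = T
    · exact Or.inl hUT
    · exact Or.inr ((h4 U).1 ⟨hUT, hU, h⟩)
  · rintro (rfl | rfl)
    · exact hFT
    · exact h7

theorem IsPseudomanifold.exists_two_bricks (hK : K.IsPseudomanifold n) {F : Finset V}
    (hF : F ∈ K.facets n) :
    ∃ T ∈ K.bricks n, ∃ T' ∈ K.bricks n, T ≠ T' ∧ ∀ U ∈ K.bricks n, F ⊆ U ↔ U = T ∨ U = T' := by
  obtain ⟨T, hT, hFT⟩ := hK.union_bricks F (mem_facets.1 hF).1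
  obtain ⟨T', hT', hne, h⟩ := hK.exists_other_brick hF hT hFT
  exact ⟨T, hT, T', hT', hne.symm, h⟩

theorem IsPseudomanifold.facetCut_nonempty (hK : K.IsPseudomanifold n)
    {S : Finset {T // T ∈ K.bricks n}} (hS : S.Nonempty) (hS' : S ≠ Finset.univ) :
    (K.facetCut n S).Nonempty := by
  obtain ⟨x, hx⟩ := hS
  obtain ⟨y, hy⟩ : ∃ y, y ∉ S := by
    by_contra! h
    exact hS' (Finset.eq_univ_iff_forall.2 h)
  obtain ⟨w⟩ := hK.connected.preconnected x y
  obtain ⟨d, -, h1, h2⟩ := w.exists_boundary_dart (S : Set _) hx hy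
  obtain ⟨-, F, hF, hF1, hF2⟩ := d.adj
  exact ⟨F, mem_cut.2 ⟨hF, ⟨_, h1, hF1⟩, ⟨_, h2, hF2⟩⟩⟩

/-- The dual graph of a pseudomanifold is `(n + 1)`-edge-connected. The facets of a cut form a cycle
modulo `2`: each `(n - 2)`-dimensional face lies in an even number of them. Hence a facet `F` in the
cut has a neighbour in the cut across each of its `n` faces of codimension one. -/
theorem IsPseudomanifold.le_card_facetCut (hK : K.IsPseudomanifold n) (hn : 0 < n)
    {S : Finset {T // T ∈ K.bricks n}} (hS : S.Nonempty) (hS' : S ≠ Finset.univ) :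
    n + 1 ≤ (K.facetCut n S).card := by
  classical
  obtain ⟨F, hF⟩ := hK.facetCut_nonempty hS hS'
  have hFf : F ∈ K.facets n := (mem_cut.1 hF).1
  have hFc := (mem_facets.1 hFf).2
  have hex : ∀ v, ∃ G, v ∈ F → G ∈ K.facetCut n S ∧ G ≠ F ∧ F.erase v ⊆ G := by
    intro v
    by_cases hv : v ∈ F
    swap
    · exact ⟨F, fun h => absurd h hv⟩
    have hcard : (F.erase v).card + 1 = n := by rw [Finset.card_erase_add_one hv, hFc]
    have heven := card_cut_mod_two (𝓕 := (K.facets n).filter (fun G => F.erase v ⊆ G))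
      (r := fun F (T : {T // T ∈ K.bricks n}) => F ⊆ T.1) (d := 0)
      (fun G hG => incident_two_of_exists_two_bricks (fun _ => hK.exists_two_bricks) G
        (Finset.mem_filter.1 hG).1)
      (fun T => by convert card_filter_facets_between hn T.2 hcard) S
    have hFmem : F ∈ cut ((K.facets n).filter (fun G => F.erase v ⊆ G))
        (fun F (T : {T // T ∈ K.bricks n}) => F ⊆ T.1) S :=
      mem_cut.2 ⟨Finset.mem_filter.2 ⟨hFf, Finset.erase_subset v F⟩, (mem_cut.1 hF).2⟩
    have hpos := Finset.card_pos.2 ⟨F, hFmem⟩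
    obtain ⟨G, hG, hGF⟩ := Finset.exists_mem_ne
      (s := cut ((K.facets n).filter (fun G => F.erase v ⊆ G))
        (fun F (T : {T // T ∈ K.bricks n}) => F ⊆ T.1) S) (by omega) F
    rw [mem_cut, Finset.mem_filter] at hG
    exact ⟨G, fun _ => ⟨mem_cut.2 ⟨hG.1.1, hG.2⟩, hGF, hG.1.2⟩⟩
  choose g hg using hex
  have hinj : Set.InjOn g F := by
    intro v hv w hw hvw
    by_contra hne
    obtain ⟨h1, h2, h3⟩ := hg v hv
    obtain ⟨-, -, h4⟩ := hg w hw
    refine h2 (Finset.eq_of_subset_of_card_le (fun u hu => ?_) ?_).symm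
    · by_cases huv : u = v
      · rw [hvw]
        exact h4 (Finset.mem_erase.2 ⟨fun h => hne (huv ▸ h), hu⟩)
      · exact h3 (Finset.mem_erase.2 ⟨huv, hu⟩)
    · rw [hFc, (mem_facets.1 (mem_cut.1 h1).1).2]
  have hnot : F ∉ F.image g := fun h => by
    obtain ⟨v, hv, hvF⟩ := Finset.mem_image.1 h
    exact (hg v hv).2.1 hvF
  have hsub : insert F (F.image g) ⊆ K.facetCut n S := by
    refine Finset.insert_subset hF (Finset.image_subset_iff.2 fun v hv => (hg v hv).1)
  calc n + 1 = (insert F (F.image g)).card := by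
        rw [Finset.card_insert_of_notMem hnot, Finset.card_image_of_injOn hinj, hFc]
    _ ≤ _ := Finset.card_le_card hsub

end Pseudomanifold

/-! ### Connected sums -/

theorem mem_image_faces_remove_and_card_iff_brick {V W : Type*} [DecidableEq W]
    {K : FiniteComplex V} {C : Finset V} {f : V → W} {n : ℕ} (hf : Function.Injective f)
    (hC : C ∈ K.bricks n) {T : Finset W} :
    (T ∈ (fun s => s.image f) '' (K.remove C).faces ∧ T.card = n + 1) ↔
      ∃ T₁ ∈ K.bricks n, T₁ ≠ C ∧ T₁.image f = T := by
  have hCc := (mem_bricks.1 hC).2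
  constructor
  · rintro ⟨⟨s, ⟨hs, hCs⟩, rfl⟩, hc⟩
    rw [Finset.card_image_of_injective _ hf] at hc
    exact ⟨s, mem_bricks.2 ⟨hs, hc⟩, fun e => hCs (e ▸ subset_rfl), rfl⟩
  · rintro ⟨s, hs, hne, rfl⟩
    rw [mem_bricks] at hs
    refine ⟨⟨s, ⟨hs.1, fun hCs => hne ?_⟩, rfl⟩, ?_⟩
    · exact (Finset.eq_of_subset_of_card_le hCs (by omega)).symm
    · rw [Finset.card_image_of_injective _ hf, hs.2]

theorem mem_image_faces_remove_and_card_iff_facet {V W : Type*} [DecidableEq W]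
    {K : FiniteComplex V} {C : Finset V} {f : V → W} {n : ℕ} (hf : Function.Injective f)
    (hC : C ∈ K.bricks n) {F : Finset W} :
    (F ∈ (fun s => s.image f) '' (K.remove C).faces ∧ F.card = n) ↔
      ∃ F₁ ∈ K.facets n, F₁.image f = F := by
  have hCc := (mem_bricks.1 hC).2
  constructor
  · rintro ⟨⟨s, ⟨hs, hCs⟩, rfl⟩, hc⟩
    rw [Finset.card_image_of_injective _ hf] at hc
    exact ⟨s, mem_facets.2 ⟨hs, hc⟩, rfl⟩
  · rintro ⟨s, hs, rfl⟩
    rw [mem_facets] at hs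
    refine ⟨⟨s, ⟨hs.1, fun hCs => ?_⟩, rfl⟩, ?_⟩
    · have := Finset.card_le_card hCs
      omega
    · rw [Finset.card_image_of_injective _ hf, hs.2]

/-- The complex `M` is the union of copies of `K₁` without `C₁` and of `K₂` without `C₂`, embedded
by `f₁` and `f₂`, which meet exactly in the common image of the boundaries of `C₁` and `C₂`. Unlike
the construction of the connected sum, this is symmetric in both summands. -/
structure IsGluing {V₁ V₂ W : Type*} [DecidableEq W] (M : FiniteComplex W) (K₁ : FiniteComplex V₁)
    (K₂ : FiniteComplex V₂) (C₁ : Finset V₁) (C₂ : Finset V₂) (f₁ : V₁ → W) (f₂ : V₂ → W) :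
    Prop where
  inj₁ : Function.Injective f₁
  inj₂ : Function.Injective f₂
  faces : M.faces = (fun s => s.image f₁) '' (K₁.remove C₁).faces ∪
    (fun s => s.image f₂) '' (K₂.remove C₂).faces
  image_eq : C₁.image f₁ = C₂.image f₂
  mem_of_eq : ∀ v w, f₁ v = f₂ w → v ∈ C₁

namespace IsGluing

variable {V₁ V₂ W : Type*} [DecidableEq W] {M : FiniteComplex W}
  {K₁ : FiniteComplex V₁} {K₂ : FiniteComplex V₂} {C₁ : Finset V₁} {C₂ : Finset V₂} {f₁ : V₁ → W}
  {f₂ : V₂ → W} {n : ℕ}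

theorem symm (h : IsGluing M K₁ K₂ C₁ C₂ f₁ f₂) : IsGluing M K₂ K₁ C₂ C₁ f₂ f₁ where
  inj₁ := h.inj₂
  inj₂ := h.inj₁
  faces := h.faces.trans (Set.union_comm _ _)
  image_eq := h.image_eq.symm
  mem_of_eq w v hwv := by
    have h1 : f₁ v ∈ C₂.image f₂ :=
      h.image_eq ▸ Finset.mem_image_of_mem f₁ (h.mem_of_eq v w hwv.symm)
    obtain ⟨w', hw', h2⟩ := Finset.mem_image.1 h1
    rwa [← h.inj₂ (h2.trans hwv.symm)]

theorem mem_bricks_iff (h : IsGluing M K₁ K₂ C₁ C₂ f₁ f₂) (hC₁ : C₁ ∈ K₁.bricks n)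
    (hC₂ : C₂ ∈ K₂.bricks n) {T : Finset W} :
    T ∈ M.bricks n ↔ (∃ T₁ ∈ K₁.bricks n, T₁ ≠ C₁ ∧ T₁.image f₁ = T) ∨
      ∃ T₂ ∈ K₂.bricks n, T₂ ≠ C₂ ∧ T₂.image f₂ = T := by
  rw [mem_bricks, h.faces, Set.mem_union, or_and_right,
    mem_image_faces_remove_and_card_iff_brick h.inj₁ hC₁,
    mem_image_faces_remove_and_card_iff_brick h.inj₂ hC₂]

theorem mem_facets_iff (h : IsGluing M K₁ K₂ C₁ C₂ f₁ f₂) (hC₁ : C₁ ∈ K₁.bricks n)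
    (hC₂ : C₂ ∈ K₂.bricks n) {F : Finset W} :
    F ∈ M.facets n ↔ (∃ F₁ ∈ K₁.facets n, F₁.image f₁ = F) ∨
      ∃ F₂ ∈ K₂.facets n, F₂.image f₂ = F := by
  rw [mem_facets, h.faces, Set.mem_union, or_and_right,
    mem_image_faces_remove_and_card_iff_facet h.inj₁ hC₁,
    mem_image_faces_remove_and_card_iff_facet h.inj₂ hC₂]

theorem subset_of_image_subset_image (h : IsGluing M K₁ K₂ C₁ C₂ f₁ f₂) {F₁ : Finset V₁}
    {T₂ : Finset V₂} (hF : F₁.image f₁ ⊆ T₂.image f₂) : F₁ ⊆ C₁ := fun v hv => by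
  obtain ⟨w, -, hw⟩ := Finset.mem_image.1 (hF (Finset.mem_image_of_mem f₁ hv))
  exact h.mem_of_eq v w hw.symm

theorem image_ne_image (h : IsGluing M K₁ K₂ C₁ C₂ f₁ f₂) (hC₁ : C₁ ∈ K₁.bricks n)
    {T₁ : Finset V₁} (hT₁ : T₁ ∈ K₁.bricks n) (hne : T₁ ≠ C₁) (T₂ : Finset V₂) :
    T₁.image f₁ ≠ T₂.image f₂ := fun e => by
  refine hne (Finset.eq_of_subset_of_card_le (h.subset_of_image_subset_image e.subset) ?_)
  rw [(mem_bricks.1 hC₁).2, (mem_bricks.1 hT₁).2]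

/-- The facets of `C₁` are identified with those of `C₂`. -/
theorem exists_facet_image_eq (h : IsGluing M K₁ K₂ C₁ C₂ f₁ f₂) (hn : 0 < n)
    (hC₂ : C₂ ∈ K₂.bricks n) {F₁ : Finset V₁} (hF₁ : F₁ ∈ K₁.facets n) (hsub : F₁ ⊆ C₁) :
    ∃ F₂ ∈ K₂.facets n, F₂ ⊆ C₂ ∧ F₂.image f₂ = F₁.image f₁ := by
  have h1 : F₁.image f₁ ⊆ C₂.image f₂ := h.image_eq ▸ Finset.image_subset_image hsub
  obtain ⟨F₂, hF₂, h2⟩ := Finset.subset_image_iff.1 h1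
  refine ⟨F₂, mem_facets_of_subset hn hC₂ hF₂ ?_, hF₂, h2⟩
  rw [← Finset.card_image_of_injective F₂ h.inj₂, h2, Finset.card_image_of_injective F₁ h.inj₁,
    (mem_facets.1 hF₁).2]

/-- The bricks of `M` which come from `K₂`. -/
noncomputable def rightBricks (M : FiniteComplex W) (K₂ : FiniteComplex V₂) (n : ℕ)
    (C₂ : Finset V₂) (f₂ : V₂ → W) : Finset {T // T ∈ M.bricks n} :=
  open Classical in
  Finset.univ.filter (fun T => ∃ T₂ ∈ K₂.bricks n, T₂ ≠ C₂ ∧ T₂.image f₂ = T.1)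

theorem mem_rightBricks {T : {T // T ∈ M.bricks n}} : T ∈ rightBricks M K₂ n C₂ f₂ ↔
    ∃ T₂ ∈ K₂.bricks n, T₂ ≠ C₂ ∧ T₂.image f₂ = T.1 := by
  simp [rightBricks]

/-- The bricks of `M` which come from `K₁` are the remaining ones. -/
theorem rightBricks_compl (h : IsGluing M K₁ K₂ C₁ C₂ f₁ f₂) (hC₁ : C₁ ∈ K₁.bricks n)
    (hC₂ : C₂ ∈ K₂.bricks n) :
    (rightBricks M K₂ n C₂ f₂)ᶜ = rightBricks M K₁ n C₁ f₁ := by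
  ext ⟨T, hT⟩
  rw [Finset.mem_compl, mem_rightBricks, mem_rightBricks]
  constructor
  · exact ((h.mem_bricks_iff hC₁ hC₂).1 hT).resolve_right
  · rintro ⟨T₁, hT₁, hne, h1⟩ ⟨T₂, -, -, h2⟩
    exact h.image_ne_image hC₁ hT₁ hne T₂ (h1.trans h2.symm)

/-- A map from the bricks of the connected sum `M` to those of the first summand `K₁` which
contracts all bricks from `K₂` to `C₁` and is the identity on the bricks from `K₁`. -/
structure IsContraction (K₁ : FiniteComplex V₁) (C₁ : Finset V₁) (f₁ : V₁ → W)
    (B : Finset {T // T ∈ M.bricks n}) (π : {T // T ∈ M.bricks n} → {T // T ∈ K₁.bricks n}) :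
    Prop where
  apply_eq : ∀ x ∈ B, (π x).1 = C₁
  apply_ne : ∀ x ∉ B, (π x).1 ≠ C₁
  image_apply : ∀ x ∉ B, (π x).1.image f₁ = x.1

theorem exists_isContraction (h : IsGluing M K₁ K₂ C₁ C₂ f₁ f₂) (hC₁ : C₁ ∈ K₁.bricks n)
    (hC₂ : C₂ ∈ K₂.bricks n) : ∃ π, IsContraction (M := M) (n := n) K₁ C₁ f₁
      (rightBricks M K₂ n C₂ f₂) π := by
  have : ∀ x : {T // T ∈ M.bricks n}, ∃ z : {T // T ∈ K₁.bricks n},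
      (x ∈ rightBricks M K₂ n C₂ f₂ → z.1 = C₁) ∧
      (x ∉ rightBricks M K₂ n C₂ f₂ → z.1 ≠ C₁ ∧ z.1.image f₁ = x.1) := by
    intro x
    by_cases hx : x ∈ rightBricks M K₂ n C₂ f₂
    · exact ⟨⟨C₁, hC₁⟩, fun _ => rfl, fun h => absurd hx h⟩
    · have hx' := Finset.mem_compl.2 hx
      rw [h.rightBricks_compl hC₁ hC₂, mem_rightBricks] at hx'
      obtain ⟨T₁, hT₁, hne, h1⟩ := hx'
      exact ⟨⟨T₁, hT₁⟩, fun h => absurd h hx, fun _ => ⟨hne, h1⟩⟩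
  choose π hπ using this
  exact ⟨π, fun x => (hπ x).1, fun x hx => ((hπ x).2 hx).1, fun x hx => ((hπ x).2 hx).2⟩

theorem IsContraction.eq_of_apply_eq
    {π : {T // T ∈ M.bricks n} → {T // T ∈ K₁.bricks n}} {B : Finset {T // T ∈ M.bricks n}}
    (hπ : IsContraction K₁ C₁ f₁ B π) (x y : {T // T ∈ M.bricks n}) (hxy : π x = π y)
    (hx : (π x).1 ≠ C₁) : x = y := by
  have hxB : x ∉ B := fun hxB => hx (hπ.apply_eq x hxB)
  have hyB : y ∉ B := fun hyB => hx (hxy ▸ hπ.apply_eq y hyB)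
  rw [Subtype.ext_iff, ← hπ.image_apply x hxB, ← hπ.image_apply y hyB, hxy]

/-- Different facets of `C₂` lie in different bricks from `K₂`. -/
theorem one_lt_card_rightBricks [DecidableEq V₂] (h : IsGluing M K₁ K₂ C₁ C₂ f₁ f₂)
    (hn : 0 < n) (hK₂ : K₂.IsPseudomanifold n) (hC₁ : C₁ ∈ K₁.bricks n)
    (hC₂ : C₂ ∈ K₂.bricks n) :
    1 < (rightBricks M K₂ n C₂ f₂).card := by
  have hCc := (mem_bricks.1 hC₂).2
  have key : ∀ v ∈ C₂, ∃ T ∈ K₂.bricks n, T ≠ C₂ ∧ C₂.erase v ⊆ T := by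
    intro v hv
    obtain ⟨T, hT, hne, hU⟩ := hK₂.exists_other_brick (mem_facets_of_subset hn hC₂
      (Finset.erase_subset v C₂) (by rw [Finset.card_erase_of_mem hv, hCc]; rfl)) hC₂
      (Finset.erase_subset v C₂)
    exact ⟨T, hT, hne, (hU T hT).2 (Or.inr rfl)⟩
  obtain ⟨v, hv, w, hw, hvw⟩ := Finset.one_lt_card.1 (show 1 < C₂.card by omega)
  obtain ⟨T, hT, hTC, hvT⟩ := key v hv
  obtain ⟨T', hT', hTC', hwT'⟩ := key w hw
  refine Finset.one_lt_card.2
    ⟨⟨T.image f₂, (h.mem_bricks_iff hC₁ hC₂).2 (Or.inr ⟨T, hT, hTC, rfl⟩)⟩,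
      mem_rightBricks.2 ⟨T, hT, hTC, rfl⟩,
      ⟨T'.image f₂, (h.mem_bricks_iff hC₁ hC₂).2 (Or.inr ⟨T', hT', hTC', rfl⟩)⟩,
      mem_rightBricks.2 ⟨T', hT', hTC', rfl⟩, fun e => hTC ?_⟩
  have hTT : T = T' := Finset.image_injective h.inj₂ (congrArg Subtype.val e)
  refine (Finset.eq_of_subset_of_card_le (fun u hu => ?_) ?_).symm
  · by_cases huv : u = v
    · rw [hTT]
      exact hwT' (Finset.mem_erase.2 ⟨fun e => hvw (huv ▸ e), hu⟩)
    · exact hvT (Finset.mem_erase.2 ⟨huv, hu⟩)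
  · rw [hCc, (mem_bricks.1 hT).2]

variable [DecidableEq V₁] [DecidableEq V₂]

theorem exists_two_bricks_image (h : IsGluing M K₁ K₂ C₁ C₂ f₁ f₂) (hn : 0 < n)
    (hK₁ : K₁.IsPseudomanifold n) (hK₂ : K₂.IsPseudomanifold n) (hC₁ : C₁ ∈ K₁.bricks n)
    (hC₂ : C₂ ∈ K₂.bricks n) {F₁ : Finset V₁} (hF₁ : F₁ ∈ K₁.facets n) :
    ∃ T ∈ M.bricks n, ∃ T' ∈ M.bricks n, T ≠ T' ∧
      ∀ U ∈ M.bricks n, F₁.image f₁ ⊆ U ↔ U = T ∨ U = T' := by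
  have hM := fun T => h.mem_bricks_iff hC₁ hC₂ (T := T)
  have hi₁ := Finset.image_injective h.inj₁
  have hi₂ := Finset.image_injective h.inj₂
  by_cases hsub : F₁ ⊆ C₁
  · obtain ⟨F₂, hF₂, hsub₂, hF⟩ := h.exists_facet_image_eq hn hC₂ hF₁ hsub
    obtain ⟨T₁, hT₁, hne₁, h₁⟩ := hK₁.exists_other_brick hF₁ hC₁ hsub
    obtain ⟨T₂, hT₂, hne₂, h₂⟩ := hK₂.exists_other_brick hF₂ hC₂ hsub₂
    refine ⟨T₁.image f₁, (hM _).2 (Or.inl ⟨T₁, hT₁, hne₁, rfl⟩), T₂.image f₂,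
      (hM _).2 (Or.inr ⟨T₂, hT₂, hne₂, rfl⟩), h.image_ne_image hC₁ hT₁ hne₁ T₂, fun U hU => ?_⟩
    rcases (hM U).1 hU with ⟨U₁, hU₁, hUne, rfl⟩ | ⟨U₂, hU₂, hUne, rfl⟩
    · rw [Finset.image_subset_image_iff h.inj₁, h₁ U₁ hU₁, hi₁.eq_iff]
      simp only [hUne, false_or, h.image_ne_image hC₁ hU₁ hUne T₂, or_false]
    · rw [← hF, Finset.image_subset_image_iff h.inj₂, h₂ U₂ hU₂, hi₂.eq_iff]
      simp only [hUne, false_or, h.symm.image_ne_image hC₂ hU₂ hUne T₁]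
  · obtain ⟨T, hT, T', hT', hne, hU⟩ := hK₁.exists_two_bricks hF₁
    have hTC : T ≠ C₁ := fun e => hsub (e ▸ (hU T hT).2 (Or.inl rfl))
    have hTC' : T' ≠ C₁ := fun e => hsub (e ▸ (hU T' hT').2 (Or.inr rfl))
    refine ⟨T.image f₁, (hM _).2 (Or.inl ⟨T, hT, hTC, rfl⟩), T'.image f₁,
      (hM _).2 (Or.inl ⟨T', hT', hTC', rfl⟩), fun e => hne (hi₁ e), fun U hUM => ?_⟩
    rcases (hM U).1 hUM with ⟨U₁, hU₁, hUne, rfl⟩ | ⟨U₂, hU₂, hUne, rfl⟩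
    · rw [Finset.image_subset_image_iff h.inj₁, hU U₁ hU₁, hi₁.eq_iff, hi₁.eq_iff]
    · refine iff_of_false (fun e => hsub (h.subset_of_image_subset_image e)) ?_
      rintro (e | e)
      · exact h.symm.image_ne_image hC₂ hU₂ hUne T e
      · exact h.symm.image_ne_image hC₂ hU₂ hUne T' e

theorem exists_two_bricks (h : IsGluing M K₁ K₂ C₁ C₂ f₁ f₂) (hn : 0 < n)
    (hK₁ : K₁.IsPseudomanifold n) (hK₂ : K₂.IsPseudomanifold n) (hC₁ : C₁ ∈ K₁.bricks n)
    (hC₂ : C₂ ∈ K₂.bricks n) : ∀ F ∈ M.facets n, ∃ T ∈ M.bricks n, ∃ T' ∈ M.bricks n, T ≠ T' ∧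
      ∀ U ∈ M.bricks n, F ⊆ U ↔ U = T ∨ U = T' := fun F hF => by
  rcases (h.mem_facets_iff hC₁ hC₂).1 hF with ⟨F₁, hF₁, rfl⟩ | ⟨F₂, hF₂, rfl⟩
  · exact h.exists_two_bricks_image hn hK₁ hK₂ hC₁ hC₂ hF₁
  · exact h.symm.exists_two_bricks_image hn hK₂ hK₁ hC₂ hC₁ hF₂

section Contraction

variable {π : {T // T ∈ M.bricks n} → {T // T ∈ K₁.bricks n}}

/-- The incidences in `K₁` are those of the contraction of `M`. -/
theorem subset_iff_exists (h : IsGluing M K₁ K₂ C₁ C₂ f₁ f₂) (hn : 0 < n)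
    (hK₂ : K₂.IsPseudomanifold n) (hC₁ : C₁ ∈ K₁.bricks n) (hC₂ : C₂ ∈ K₂.bricks n)
    (hπ : IsContraction K₁ C₁ f₁ (rightBricks M K₂ n C₂ f₂) π) {F₁ : Finset V₁}
    (hF₁ : F₁ ∈ K₁.facets n) (z : {T // T ∈ K₁.bricks n}) :
    F₁ ⊆ z.1 ↔ ∃ x, π x = z ∧ F₁.image f₁ ⊆ x.1 := by
  constructor
  · intro hF
    by_cases hz : z.1 = C₁
    · rw [hz] at hF
      obtain ⟨F₂, hF₂, hsub, hFF⟩ := h.exists_facet_image_eq hn hC₂ hF₁ hF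
      obtain ⟨T₂, hT₂, hne, hT⟩ := hK₂.exists_other_brick hF₂ hC₂ hsub
      refine ⟨⟨T₂.image f₂, (h.mem_bricks_iff hC₁ hC₂).2 (Or.inr ⟨T₂, hT₂, hne, rfl⟩)⟩, ?_, ?_⟩
      · rw [Subtype.ext_iff, hz]
        exact hπ.apply_eq _ (mem_rightBricks.2 ⟨T₂, hT₂, hne, rfl⟩)
      · rw [← hFF]
        exact Finset.image_subset_image ((hT T₂ hT₂).2 (Or.inr rfl))
    · have hmem := (h.mem_bricks_iff hC₁ hC₂).2 (Or.inl ⟨z.1, z.2, hz, rfl⟩)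
      refine ⟨⟨z.1.image f₁, hmem⟩, ?_, Finset.image_subset_image hF⟩
      rw [Subtype.ext_iff]
      refine Finset.image_injective h.inj₁ (hπ.image_apply _ fun hx => ?_)
      obtain ⟨T₂, -, -, h2⟩ := mem_rightBricks.1 hx
      exact h.image_ne_image hC₁ z.2 hz T₂ h2.symm
  · rintro ⟨x, rfl, hF⟩
    by_cases hx : x ∈ rightBricks M K₂ n C₂ f₂
    · rw [hπ.apply_eq x hx]
      obtain ⟨T₂, -, -, h2⟩ := mem_rightBricks.1 hx
      exact h.subset_of_image_subset_image (h2 ▸ hF)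
    · rwa [← hπ.image_apply x hx, Finset.image_subset_image_iff h.inj₁] at hF

theorem contraction_surjective (h : IsGluing M K₁ K₂ C₁ C₂ f₁ f₂) (hn : 0 < n)
    (hK₂ : K₂.IsPseudomanifold n) (hC₁ : C₁ ∈ K₁.bricks n) (hC₂ : C₂ ∈ K₂.bricks n)
    (hπ : IsContraction K₁ C₁ f₁ (rightBricks M K₂ n C₂ f₂) π) : Function.Surjective π := by
  intro z
  obtain ⟨F, hFz, hF⟩ := Finset.exists_subset_card_eq
    (show n ≤ z.1.card by rw [(mem_bricks.1 z.2).2]; omega)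
  obtain ⟨x, hx, -⟩ := (h.subset_iff_exists hn hK₂ hC₁ hC₂ hπ
    (mem_facets_of_subset hn z.2 hFz hF) z).1 hFz
  exact ⟨x, hx⟩

/-- Cuts of `K₁` have the same size as their preimages in `M`. -/
theorem card_facetCut_preimage (h : IsGluing M K₁ K₂ C₁ C₂ f₁ f₂) (hn : 0 < n)
    (hK₂ : K₂.IsPseudomanifold n) (hC₁ : C₁ ∈ K₁.bricks n) (hC₂ : C₂ ∈ K₂.bricks n)
    (hπ : IsContraction K₁ C₁ f₁ (rightBricks M K₂ n C₂ f₂) π)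
    (T : Finset {T // T ∈ K₁.bricks n}) :
    (M.facetCut n (Finset.univ.filter (fun x => π x ∈ T))).card = (K₁.facetCut n T).card := by
  have key : ∀ F₁ ∈ K₁.facets n, (F₁.image f₁ ∈
      M.facetCut n (Finset.univ.filter (fun x => π x ∈ T)) ↔ F₁ ∈ K₁.facetCut n T) := by
    intro F₁ hF₁
    have hs := h.subset_iff_exists hn hK₂ hC₁ hC₂ hπ hF₁
    have hM : F₁.image f₁ ∈ M.facets n := (h.mem_facets_iff hC₁ hC₂).2 (Or.inl ⟨F₁, hF₁, rfl⟩)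
    simp only [facetCut, mem_cut, hs, hF₁, hM, Finset.mem_filter, Finset.mem_univ, true_and]
    refine and_congr ⟨?_, ?_⟩ ⟨?_, ?_⟩
    · rintro ⟨x, hx, hF⟩
      exact ⟨_, hx, x, rfl, hF⟩
    · rintro ⟨_, hx, x, rfl, hF⟩
      exact ⟨x, hx, hF⟩
    · rintro ⟨x, hx, hF⟩
      exact ⟨_, hx, x, rfl, hF⟩
    · rintro ⟨_, hx, x, rfl, hF⟩
      exact ⟨x, hx, hF⟩
  have himage : M.facetCut n (Finset.univ.filter (fun x => π x ∈ T)) =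
      (K₁.facetCut n T).image (fun F => F.image f₁) := by
    ext F
    constructor
    · intro hF
      obtain ⟨hFM, ⟨x, hx, hFx⟩, ⟨y, hy, hFy⟩⟩ := mem_cut.1 hF
      have hF₁ : ∃ F₁ ∈ K₁.facets n, F₁.image f₁ = F := by
        by_contra hno
        -- a facet which does not come from `K₁` only lies in bricks which are contracted to `C₁`
        have hall : ∀ u : {T // T ∈ M.bricks n}, F ⊆ u.1 → u ∈ rightBricks M K₂ n C₂ f₂ := by
          intro u hu
          by_contra hu'
          obtain ⟨F₂, hF₂, rfl⟩ := ((h.mem_facets_iff hC₁ hC₂).1 hFM).resolve_left hno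
          rw [← hπ.image_apply u hu'] at hu
          obtain ⟨F₁, hF₁, -, h1⟩ := h.symm.exists_facet_image_eq hn hC₁ hF₂
            (h.symm.subset_of_image_subset_image hu)
          exact hno ⟨F₁, hF₁, h1⟩
        have hxy : π x = π y := Subtype.ext
          ((hπ.apply_eq x (hall x hFx)).trans (hπ.apply_eq y (hall y hFy)).symm)
        simp only [Finset.mem_filter, Finset.mem_univ, true_and] at hx hy
        exact hy (hxy ▸ hx)
      obtain ⟨F₁, hF₁, rfl⟩ := hF₁
      exact Finset.mem_image_of_mem _ ((key F₁ hF₁).1 hF)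
    · intro hF
      obtain ⟨F₁, hF₁, rfl⟩ := Finset.mem_image.1 hF
      exact (key F₁ (mem_cut.1 hF₁).1).2 hF₁
  rw [himage, Finset.card_image_of_injective _ (Finset.image_injective h.inj₁)]

end Contraction

/-- Cuts of `M` which do not separate the bricks from `K₂` are cuts of `K₁`. -/
theorem le_card_facetCut_of_saturated (h : IsGluing M K₁ K₂ C₁ C₂ f₁ f₂) (hn : 0 < n)
    (hK₁ : K₁.IsPseudomanifold n) (hK₂ : K₂.IsPseudomanifold n) (hC₁ : C₁ ∈ K₁.bricks n)
    (hC₂ : C₂ ∈ K₂.bricks n) {S : Finset {T // T ∈ M.bricks n}} (hS : S.Nonempty)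
    (hS' : S ≠ Finset.univ)
    (hB : Disjoint S (rightBricks M K₂ n C₂ f₂) ∨ rightBricks M K₂ n C₂ f₂ ⊆ S) :
    n + 1 ≤ (M.facetCut n S).card := by
  obtain ⟨π, hπ⟩ := h.exists_isContraction (n := n) hC₁ hC₂
  have hSπ : S = Finset.univ.filter (fun x => π x ∈ S.image π) := by
    ext x
    simp only [Finset.mem_filter, Finset.mem_univ, true_and]
    refine ⟨Finset.mem_image_of_mem π, fun hx => ?_⟩
    obtain ⟨y, hy, hyx⟩ := Finset.mem_image.1 hx
    by_cases hyC : (π y).1 = C₁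
    · have h1 : ∀ u, (π u).1 = C₁ → u ∈ rightBricks M K₂ n C₂ f₂ := fun u hu => by
        by_contra hu'
        exact hπ.apply_ne u hu' hu
      rcases hB with hB | hB
      · exact absurd (h1 y hyC) (Finset.disjoint_left.1 hB hy)
      · exact hB (h1 x (hyx ▸ hyC))
    · exact hπ.eq_of_apply_eq y x hyx hyC ▸ hy
  rw [hSπ, h.card_facetCut_preimage hn hK₂ hC₁ hC₂ hπ]
  refine hK₁.le_card_facetCut hn (hS.image π) fun e => hS' ?_
  rw [hSπ, e]
  simp

/-- The cut between both summands consists of the facets of `C₁`. -/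
theorem card_facetCut_rightBricks (h : IsGluing M K₁ K₂ C₁ C₂ f₁ f₂) (hn : 0 < n)
    (hK₁ : K₁.IsPseudomanifold n) (hK₂ : K₂.IsPseudomanifold n) (hC₁ : C₁ ∈ K₁.bricks n)
    (hC₂ : C₂ ∈ K₂.bricks n) : (M.facetCut n (rightBricks M K₂ n C₂ f₂)).card = n + 1 := by
  obtain ⟨π, hπ⟩ := h.exists_isContraction (n := n) hC₁ hC₂
  have h1 : rightBricks M K₂ n C₂ f₂ =
      Finset.univ.filter (fun x => π x ∈ ({⟨C₁, hC₁⟩} : Finset {T // T ∈ K₁.bricks n})) := by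
    ext x
    simp only [Finset.mem_filter, Finset.mem_univ, true_and, Finset.mem_singleton, Subtype.ext_iff]
    exact ⟨hπ.apply_eq x, fun hx => by_contra fun hx' => hπ.apply_ne x hx' hx⟩
  have h2 : K₁.facetCut n ({⟨C₁, hC₁⟩} : Finset {T // T ∈ K₁.bricks n}) =
      (K₁.facets n).filter (fun F => F ⊆ C₁) := by
    ext F
    rw [facetCut, mem_cut, Finset.mem_filter]
    refine and_congr_right fun hF => ⟨?_, fun hFC => ?_⟩
    · rintro ⟨⟨x, hx, hFx⟩, -⟩
      rw [Finset.mem_singleton.1 hx] at hFx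
      exact hFx
    · obtain ⟨T, hT, hne, hU⟩ := hK₁.exists_other_brick hF hC₁ hFC
      refine ⟨⟨_, Finset.mem_singleton_self _, hFC⟩, ⟨T, hT⟩, ?_, (hU T hT).2 (Or.inr rfl)⟩
      rw [Finset.mem_singleton, Subtype.ext_iff]
      exact hne
  rw [h1, h.card_facetCut_preimage hn hK₂ hC₁ hC₂ hπ, h2, card_filter_facets_subset hn hC₁]

/-- The dual graph of a connected sum is `(n + 1)`-edge-connected, like those of the summands. -/
theorem le_card_facetCut (h : IsGluing M K₁ K₂ C₁ C₂ f₁ f₂) (hn : 0 < n)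
    (hK₁ : K₁.IsPseudomanifold n) (hK₂ : K₂.IsPseudomanifold n) (hC₁ : C₁ ∈ K₁.bricks n)
    (hC₂ : C₂ ∈ K₂.bricks n) {S : Finset {T // T ∈ M.bricks n}} (hS : S.Nonempty)
    (hS' : S ≠ Finset.univ) : n + 1 ≤ (M.facetCut n S).card := by
  have hcompl := h.rightBricks_compl (n := n) hC₁ hC₂
  set A := rightBricks M K₁ n C₁ f₁ with hA
  set B := rightBricks M K₂ n C₂ f₂ with hB
  have h₁ : ∀ S : Finset {T // T ∈ M.bricks n}, S.Nonempty → S ≠ Finset.univ →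
      Disjoint S B ∨ B ⊆ S → n + 1 ≤ (M.facetCut n S).card := fun S hS hS' =>
    h.le_card_facetCut_of_saturated hn hK₁ hK₂ hC₁ hC₂ hS hS'
  have h₂ : ∀ S : Finset {T // T ∈ M.bricks n}, S.Nonempty → S ≠ Finset.univ →
      Disjoint S A ∨ A ⊆ S → n + 1 ≤ (M.facetCut n S).card := fun S hS hS' =>
    h.symm.le_card_facetCut_of_saturated hn hK₂ hK₁ hC₂ hC₁ hS hS'
  by_cases h3 : (S ∩ A).Nonempty
  · by_cases h4 : S ∪ A = Finset.univ
    · refine h₁ S hS hS' (Or.inr fun x hx => ?_)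
      have := h4 ▸ Finset.mem_univ x
      rw [← hcompl, Finset.mem_union, Finset.mem_compl] at this
      tauto
    · -- uncrossing with the cut between both summands
      have h5 := card_cut_union_add_card_cut_inter_le (𝓕 := M.facets n)
        (r := fun F (T : {T // T ∈ M.bricks n}) => F ⊆ T.1) S A
      have h6 := h₁ (S ∩ A) h3 (fun e => hS' (Finset.eq_univ_iff_forall.2 fun x =>
        (Finset.mem_inter.1 (e ▸ Finset.mem_univ x)).1)) (Or.inl ?_)
      · have h7 := h₂ (S ∪ A) (hS.mono Finset.subset_union_left) h4
          (Or.inr Finset.subset_union_right)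
        have h8 := h.symm.card_facetCut_rightBricks hn hK₂ hK₁ hC₂ hC₁
        rw [← hA] at h8
        unfold facetCut at *
        omega
      · rw [← hcompl]
        exact Finset.disjoint_left.2 fun x hx => Finset.mem_compl.1 (Finset.mem_inter.1 hx).2
  · refine h₂ S hS hS' (Or.inl ?_)
    rwa [Finset.disjoint_iff_inter_eq_empty, ← Finset.not_nonempty_iff_eq_empty]

/-- The cut between both summands is a minimal cut of `M`. Its size `n + 1` is odd as `n` is even,
and for the same reason the parity of a cut is that of the number of bricks on one side. -/
theorem isOddMinCut (h : IsGluing M K₁ K₂ C₁ C₂ f₁ f₂) (hn : 0 < n) (hn' : Even n)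
    (hK₁ : K₁.IsPseudomanifold n) (hK₂ : K₂.IsPseudomanifold n) (hC₁ : C₁ ∈ K₁.bricks n)
    (hC₂ : C₂ ∈ K₂.bricks n) :
    IsOddMinCut (fun S => (M.facetCut n S).card) (rightBricks M K₂ n C₂ f₂) where
  submod S T := card_cut_union_add_card_cut_inter_le S T
  compl S := congrArg Finset.card (cut_compl S)
  parity S := by
    have h1 := card_cut_mod_two (d := 1)
      (incident_two_of_exists_two_bricks (h.exists_two_bricks hn hK₁ hK₂ hC₁ hC₂))
      (fun T => by
        have h2 := card_filter_facets_subset hn T.2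
        obtain ⟨k, hk⟩ := hn'
        rw [show 1 % 2 = (n + 1) % 2 by omega, ← h2]
        congr!) S
    rwa [mul_one] at h1
  le S hS hS' := by
    simp only [h.card_facetCut_rightBricks hn hK₁ hK₂ hC₁ hC₂]
    exact h.le_card_facetCut hn hK₁ hK₂ hC₁ hC₂ hS hS'
  odd := by
    simp only [h.card_facetCut_rightBricks hn hK₁ hK₂ hC₁ hC₂]
    obtain ⟨k, hk⟩ := hn'
    omega
  one_lt := h.one_lt_card_rightBricks hn hK₂ hC₁ hC₂

/-- The width of a summand is at most the width of the connected sum. -/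
theorem width_le (h : IsGluing M K₁ K₂ C₁ C₂ f₁ f₂) (hn : 0 < n) (hn' : Even n)
    (hK₁ : K₁.IsPseudomanifold n) (hK₂ : K₂.IsPseudomanifold n) (hC₁ : C₁ ∈ K₁.bricks n)
    (hC₂ : C₂ ∈ K₂.bricks n) : K₁.width n (fun _ => 1) ≤ M.width n (fun _ => 1) := by
  obtain ⟨π, hπ⟩ := h.exists_isContraction (n := n) hC₁ hC₂
  obtain ⟨O, hO⟩ := M.exists_width_eq_orderingWidth n (fun _ => 1)
  obtain ⟨O', hO'⟩ := (h.isOddMinCut hn hn' hK₁ hK₂ hC₁ hC₂).exists_sequenceWidth_lt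
    (π := π) (c := ⟨C₁, hC₁⟩)
    (fun x => ⟨fun hx => Subtype.ext (hπ.apply_eq x hx), fun hx => by_contra fun hx' =>
      hπ.apply_ne x hx' (congrArg Subtype.val hx)⟩)
    (h.contraction_surjective hn hK₂ hC₁ hC₂ hπ)
    (fun x y hxy hx => hπ.eq_of_apply_eq x y hxy fun e => hx (Subtype.ext e))
    O (Fintype.card_coe (K₁.bricks n))
  refine (K₁.width_le_orderingWidth _ O').trans ?_
  rw [hO, orderingWidth_one, orderingWidth_one]
  simp only [h.card_facetCut_preimage hn hK₂ hC₁ hC₂ hπ] at hO'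
  exact hO'.le

end IsGluing

/-- The connected sum, in the symmetric description of both summands. -/
theorem isGluing_connectedSum {V₁ V₂ : Type*} [DecidableEq V₁] [DecidableEq V₂]
    (K₁ : FiniteComplex V₁) (K₂ : FiniteComplex V₂) (C₁ : Finset V₁) (C₂ : Finset V₂)
    (e : {v // v ∈ C₁} ≃ {v // v ∈ C₂}) :
    IsGluing (connectedSum K₁ K₂ C₁ C₂ e) K₁ K₂ C₁ C₂ Sum.inl (glueVertex e) where
  inj₁ := Sum.inl_injective
  inj₂ v w hvw := by
    unfold glueVertex at hvw
    split_ifs at hvw with hv hw hw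
    · have := e.symm.injective (Subtype.ext (Sum.inl_injective hvw))
      exact congrArg Subtype.val this
    · exact congrArg Subtype.val (Sum.inr_injective hvw)
  faces := rfl
  image_eq := by
    ext u
    simp only [Finset.mem_image]
    constructor
    · rintro ⟨v, hv, rfl⟩
      refine ⟨(e ⟨v, hv⟩).1, (e ⟨v, hv⟩).2, ?_⟩
      rw [glueVertex, dif_pos (e ⟨v, hv⟩).2, Subtype.coe_eta, Equiv.symm_apply_apply]
    · rintro ⟨v, hv, rfl⟩
      exact ⟨(e.symm ⟨v, hv⟩).1, (e.symm ⟨v, hv⟩).2, by rw [glueVertex, dif_pos hv]⟩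
  mem_of_eq v w hvw := by
    unfold glueVertex at hvw
    split_ifs at hvw with hw
    · rw [Sum.inl_injective hvw]
      exact (e.symm ⟨w, hw⟩).2

end FiniteComplex

theorem mainTheorem3 {V₁ V₂ : Type*} [DecidableEq V₁] [DecidableEq V₂]
    (n : ℕ) (hn : 2 ≤ n) (hn_even : Even n)
    (M₁ : FiniteComplex V₁) (M₂ : FiniteComplex V₂)
    (hM₁ : M₁.IsPseudomanifold n) (hM₂ : M₂.IsPseudomanifold n)
    (C₁ : Finset V₁) (hC₁ : C₁ ∈ M₁.bricks n)
    (C₂ : Finset V₂) (hC₂ : C₂ ∈ M₂.bricks n)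
    (e : {v // v ∈ C₁} ≃ {v // v ∈ C₂}) :
    max (M₁.width n (fun _ => 1)) (M₂.width n (fun _ => 1)) ≤
      (FiniteComplex.connectedSum M₁ M₂ C₁ C₂ e).width n (fun _ => 1) := by
  have h := FiniteComplex.isGluing_connectedSum M₁ M₂ C₁ C₂ e
  exact max_le (h.width_le (by omega) hn_even hM₁ hM₂ hC₁ hC₂)
    (h.symm.width_le (by omega) hn_even hM₂ hM₁ hC₂ hC₁)
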